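/- Let $L>0$. For every $\delta\ge 0$ let $|\cdot|_\delta:\mathbb R\to\mathbb R_{\ge 0}$ be given such that, with constants $c_0>0$ and $c_1,c_2,c_{\rm uni}$, one has $\big||x|_\delta-|x|\big|\le c_{\rm uni}\delta$ for all $x\in\mathbb R$, $\delta\ge 0$ (so $|\cdot|_0=|\cdot|$), and, for $\delta>0$, $|\cdot|_\delta\in C^2(\mathbb R)$, $|\cdot|_\delta\ge c_0\delta$, $|\cdot|_\delta'\le c_1$, $|\cdot|_\delta''\le c_2\delta^{-1}$. Set $$\overline Q(\alpha,\beta)=\begin{cases}(\alpha^2+\beta^2)^2/\alpha^2,&|\alpha|\ge|\beta|,\ \alpha\ne0,\\ 4\beta^2,&|\alpha|<|\beta|\text{ or }\alpha=\beta=0,\end{cases}$$ $$\overline Q_\delta(\alpha,\beta)=2\beta^2+\tfrac12\alpha^2+\tfrac12\beta^2+\tfrac12|\alpha^2-\beta^2|_\delta+\frac{2\beta^4}{\alpha^2+\beta^2+|\alpha^2-\beta^2|_\delta}$$ (the last fraction being read as $0$ when its denominator vanishes), and for $(y,b)\in V:=H^2(0,L;\mathbb R^3)\times H^1(0,L;\mathbb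 R^3)$, $\delta\ge0$, $\varepsilon_2>0$, $$E[y,b]=\int_0^L\overline Q(|y''|,|b'|)\,dx,\qquad E_{\delta,\varepsilon_2}[y,b]=\int_0^L\overline Q_\delta(|y''|,|b'|)\,dx+\frac1{2\varepsilon_2}\int_0^L(y'\cdot b')^2\,dx .$$ Let $L_{\rm bc}$ be a bounded linear operator on $V$ into a normed space $W$ that depends only on the boundary values of $y$, $y'$, $b$ at $0$ and $L$, let $\ell_{\rm bc}\in W$, and let the set of admissible frames be $$\mathcal A_{\rm frame}=\{(y,b)\in V:\ [y',b,y'\times b]\in SO(3)\text{ a.e. in }(0,L),\ L_{\rm bc}[y,b]=\ell_{\rm bc}\}.$$ (Strong approximability.) There is a constant $c>0$, independent of $(y,b)$, $\sigma$, $\delta$ and $\varepsilon_2$, such that for every $(y,b)\in\mathcal A_{\rm frame}$ with $y'\cdot b'=0$ a.e. and every $\sigma>0$ there exists $(y_\sigma,b_\sigma)\in\mathcal A_{\rm frame}$ with $y_\sigma,b_\sigma\in C^\infty([0,L];\mathbb R^3)$, $$\|y-y_\sigma\|_{H^2(0,L)}+\|b-b_\sigma\|_{H^1(0,L)}+\|y_\sigma'\cdot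 b_\sigma'\|_{L^2(0,L)}\le\sigma,$$ and, for all $\delta\ge0$ and $\varepsilon_2>0$, $$\big|E[y,b]-E_{\delta,\varepsilon_2}[y_\sigma,b_\sigma]\big|\le c\,\big(\sigma^2\varepsilon_2^{-1}+\delta+\sigma\big).$$ ($\Gamma$-convergence.) Extend $E_{\delta,\varepsilon_2}$ by $+\infty$ to $V\setminus\mathcal A_{\rm frame}$, and $E$ by $+\infty$ off $\{(y,b)\in\mathcal A_{\rm frame}: y'\cdot b'=0\text{ a.e.}\}$. For all sequences $\delta_n\ge0$, $\varepsilon_n>0$ with $(\delta_n,\varepsilon_n)\to(0,0)$, the functionals $E_{\delta_n,\varepsilon_n}$ are sequentially $\Gamma$-convergent to $E$; and for every fixed $\varepsilon_2>0$ and every sequence $\delta_n\ge 0$ with $\delta_n\to0$, the functionals $E_{\delta_n,\varepsilon_2}$ are sequentially $\Gamma$-convergent to $E_{0,\varepsilon_2}$. Both hold with respect to weak as well as with respect to strong convergence in $V$; that is, the liminf inequality holds along all weakly convergent sequences, and recovery sequences converging strongly exist. -/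

import Mathlib

open MeasureTheory Filter Topology Set
open scoped ContDiff

noncomputable section

namespace Ribbon

/-- Euclidean three-space. -/
abbrev E3 : Type := EuclideanSpace ℝ (Fin 3)

/-- Lebesgue measure on the interval `(0, L)`. -/
abbrev vol (L : ℝ) : Measure ℝ := volume.restrict (Ioo 0 L)

/-- The space `L²(0, L; ℝ³)`. -/
abbrev L2 (L : ℝ) : Type := Lp E3 2 (vol L)

/-- Test functions `φ ∈ C_c^∞(0, L)`. -/
structure IsTest (L : ℝ) (φ : ℝ → ℝ) : Prop where
  smooth : ContDiff ℝ ∞ φ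
  compact : HasCompactSupport φ
  support : tsupport φ ⊆ Ioo 0 L

/-- `v` is the weak derivative of `u` on `(0, L)`. -/
def IsWeakDeriv (L : ℝ) (u v : L2 L) : Prop :=
  ∀ φ : ℝ → ℝ, IsTest L φ →
    ∫ x in Ioo 0 L, deriv φ x • u x = - ∫ x in Ioo 0 L, φ x • v x

theorem integrable_smul {L : ℝ} (u : L2 L) {ψ : ℝ → ℝ} (hψ : Continuous ψ)
    (hc : HasCompactSupport ψ) : Integrable (fun x => ψ x • u x) (vol L) := by
  obtain ⟨C, hC⟩ := hc.exists_bound_of_continuous hψ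
  exact ((Lp.memLp u).integrable (by norm_num)).bdd_smul C hψ.aestronglyMeasurable
    (Eventually.of_forall hC)

theorem IsTest.continuous_deriv {L : ℝ} {φ : ℝ → ℝ} (h : IsTest L φ) :
    Continuous (deriv φ) :=
  h.smooth.continuous_deriv (by simp)

/-- The Sobolev space `H^k(0, L; ℝ³)`. A function `u` is represented by the tuple
`(u, u', …, u^(k))` of its weak derivatives, which are determined by `u`, so that the norm is the
usual one, `‖u‖² = ∑ j ≤ k, ‖u^(j)‖²`, with `L²` norms on the right. -/
def sobolev (L : ℝ) (k : ℕ) : Submodule ℝ (PiLp 2 (fun _ : Fin (k + 1) => L2 L)) where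
  carrier := {u | ∀ j : Fin k, IsWeakDeriv L (u j.castSucc) (u j.succ)}
  zero_mem' := by
    intro j φ _
    have key : ∀ ψ : ℝ → ℝ, ∫ x in Ioo 0 L, ψ x • (0 : L2 L) x = 0 := by
      intro ψ
      refine integral_eq_zero_of_ae ?_
      filter_upwards [Lp.coeFn_zero E3 2 (vol L)] with x hx
      rw [hx]
      exact smul_zero _
    simp only [PiLp.zero_apply]
    rw [key, key, neg_zero]
  add_mem' := by
    intro u v hu hv j φ hφ
    have key : ∀ (a b : L2 L) (ψ : ℝ → ℝ), Continuous ψ → HasCompactSupport ψ →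
        ∫ x in Ioo 0 L, ψ x • (a + b : L2 L) x
          = (∫ x in Ioo 0 L, ψ x • a x) + ∫ x in Ioo 0 L, ψ x • b x := by
      intro a b ψ h1 h2
      rw [← integral_add (integrable_smul a h1 h2) (integrable_smul b h1 h2)]
      refine integral_congr_ae ?_
      filter_upwards [Lp.coeFn_add a b] with x hx
      rw [hx, Pi.add_apply, smul_add]
    have h1 := hu j φ hφ
    have h2 := hv j φ hφ
    simp only [PiLp.add_apply]
    rw [key _ _ _ hφ.continuous_deriv hφ.compact.deriv,
      key _ _ _ hφ.smooth.continuous hφ.compact, h1, h2, neg_add]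
  smul_mem' := by
    intro c u hu j φ hφ
    have key : ∀ (a : L2 L) (ψ : ℝ → ℝ),
        ∫ x in Ioo 0 L, ψ x • (c • a : L2 L) x = c • ∫ x in Ioo 0 L, ψ x • a x := by
      intro a ψ
      rw [← integral_smul]
      refine integral_congr_ae ?_
      filter_upwards [Lp.coeFn_smul c a] with x hx
      rw [hx, Pi.smul_apply, smul_comm]
    have h1 := hu j φ hφ
    simp only [PiLp.smul_apply]
    rw [key, key, h1, smul_neg]

/-- The space `H²(0, L; ℝ³)`. -/
abbrev H2 (L : ℝ) : Type := sobolev L 2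

/-- The space `H¹(0, L; ℝ³)`. -/
abbrev H1 (L : ℝ) : Type := sobolev L 1

/-- The `j`-th weak derivative `u^(j)`, `0 ≤ j ≤ k`, of `u ∈ H^k(0, L; ℝ³)`. -/
def D {L : ℝ} {k : ℕ} (j : Fin (k + 1)) (u : sobolev L k) : L2 L :=
  (u : PiLp 2 (fun _ : Fin (k + 1) => L2 L)) j

/-- `f` is a continuous representative on `[0, L]` of `u ∈ L²(0, L; ℝ³)`. -/
def IsContRep (L : ℝ) (u : L2 L) (f : ℝ → E3) : Prop :=
  ContinuousOn f (Icc 0 L) ∧ u =ᵐ[vol L] f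

/-- `u ∈ H^k(0, L; ℝ³)` is smooth on `[0, L]`. -/
def IsSmooth {L : ℝ} {k : ℕ} (u : sobolev L k) : Prop :=
  ∃ f : ℝ → E3, ContDiffOn ℝ ∞ f (Icc 0 L) ∧ D 0 u =ᵐ[vol L] f

/-- The matrix with columns `p`, `q`, `p × q`. -/
def frameMatrix (p q : E3) : Matrix (Fin 3) (Fin 3) ℝ :=
  (Matrix.of ![p.ofLp, q.ofLp, crossProduct p.ofLp q.ofLp]).transpose

/-- The space of the boundary values `(y(0), y(L), y'(0), y'(L), b(0), b(L))`. -/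
abbrev BdryVals : Type := E3 × E3 × E3 × E3 × E3 × E3

/-- The boundary condition `L_bc[y, b] = ℓ_bc`, where the operator depends only on the boundary
values of (the continuous representatives of) `y`, `y'` and `b`. -/
def SatisfiesBC {L : ℝ} {W : Type*} [NormedAddCommGroup W] [NormedSpace ℝ W]
    (Lbc : BdryVals →L[ℝ] W) (lbc : W) (y : H2 L) (b : H1 L) : Prop :=
  ∃ f g h : ℝ → E3, IsContRep L (D 0 y) f ∧ IsContRep L (D 1 y) g ∧ IsContRep L (D 0 b) h ∧
    Lbc (f 0, f L, g 0, g L, h 0, h L) = lbc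

/-- The set of admissible frames. -/
def admissible {W : Type*} [NormedAddCommGroup W] [NormedSpace ℝ W] (L : ℝ)
    (Lbc : BdryVals →L[ℝ] W) (lbc : W) : Set (H2 L × H1 L) :=
  {p | (∀ᵐ x ∂(vol L), frameMatrix (D 1 p.1 x) (D 0 p.2 x) ∈
      Matrix.specialOrthogonalGroup (Fin 3) ℝ) ∧ SatisfiesBC Lbc lbc p.1 p.2}

/-- The constraint `y' · b' = 0` almost everywhere in `(0, L)`. -/
def Unshearable {L : ℝ} (p : H2 L × H1 L) : Prop :=
  ∀ᵐ x ∂(vol L), inner ℝ (D 1 p.1 x) (D 1 p.2 x) = 0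

/-- The corrected Sadowsky energy density. -/
def Qbar (α β : ℝ) : ℝ :=
  if |β| ≤ |α| then (α ^ 2 + β ^ 2) ^ 2 / α ^ 2 else 4 * β ^ 2

/-- `m δ` is a regularized modulus function `|·|_δ` for every `δ ≥ 0`. -/
structure IsRegModulus (m : ℝ → ℝ → ℝ) (c₀ c₁ c₂ cuni : ℝ) : Prop where
  c₀_pos : 0 < c₀
  nonneg : ∀ δ, 0 ≤ δ → ∀ x, 0 ≤ m δ x
  contDiff : ∀ δ, 0 < δ → ContDiff ℝ 2 (m δ)
  lower : ∀ δ, 0 < δ → ∀ x, c₀ * δ ≤ m δ x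
  deriv_le : ∀ δ, 0 < δ → ∀ x, deriv (m δ) x ≤ c₁
  deriv_deriv_le : ∀ δ, 0 < δ → ∀ x, deriv (deriv (m δ)) x ≤ c₂ * δ⁻¹
  uniform : ∀ δ, 0 ≤ δ → ∀ x, |m δ x - abs x| ≤ cuni * δ

/-- The regularized energy density. -/
def Qreg (m : ℝ → ℝ → ℝ) (δ α β : ℝ) : ℝ :=
  2 * β ^ 2 + 1 / 2 * α ^ 2 + 1 / 2 * β ^ 2 + 1 / 2 * m δ (α ^ 2 - β ^ 2)
    + 2 * β ^ 4 / (α ^ 2 + β ^ 2 + m δ (α ^ 2 - β ^ 2))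

/-- The energy `E[y, b]`. -/
def energy {L : ℝ} (p : H2 L × H1 L) : ℝ :=
  ∫ x in Ioo 0 L, Qbar ‖D 2 p.1 x‖ ‖D 1 p.2 x‖

/-- `∫ (y' · b')²` over `(0, L)`. -/
def shearSq {L : ℝ} (p : H2 L × H1 L) : ℝ :=
  ∫ x in Ioo 0 L, (inner ℝ (D 1 p.1 x) (D 1 p.2 x)) ^ 2

/-- The regularized and penalized energy `E_{δ,ε}[y, b]`. -/
def energyReg {L : ℝ} (m : ℝ → ℝ → ℝ) (δ ε : ℝ) (p : H2 L × H1 L) : ℝ :=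
  (∫ x in Ioo 0 L, Qreg m δ ‖D 2 p.1 x‖ ‖D 1 p.2 x‖) + 1 / (2 * ε) * shearSq p

open Classical in
/-- The functional with value `+∞` off the set `A`. -/
def constrained {X : Type*} (A : Set X) (F : X → ℝ) (p : X) : EReal :=
  if p ∈ A then (F p : EReal) else ⊤

/-- Weak convergence of a sequence in a normed space. -/
def WeakConv {X : Type*} [NormedAddCommGroup X] [NormedSpace ℝ X] (u : ℕ → X) (x : X) : Prop :=
  ∀ f : X →L[ℝ] ℝ, Tendsto (fun n => f (u n)) atTop (𝓝 (f x))

/-- Strong convergence of a sequence in a normed space. -/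
def StrongConv {X : Type*} [NormedAddCommGroup X] (u : ℕ → X) (x : X) : Prop :=
  Tendsto u atTop (𝓝 x)

/-- Sequential `Γ`-convergence of `F n` to `F₀` with respect to the convergence `conv`: the lower
bound inequality and the existence of recovery sequences. -/
def GammaConv {X : Type*} (conv : (ℕ → X) → X → Prop) (F : ℕ → X → EReal) (F₀ : X → EReal) :
    Prop :=
  (∀ (x : X) (u : ℕ → X), conv u x → F₀ x ≤ liminf (fun n => F n (u n)) atTop) ∧
  (∀ x : X, ∃ u : ℕ → X, conv u x ∧ limsup (fun n => F n (u n)) atTop ≤ F₀ x)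

/-- `Γ`-convergence in `H² × H¹` along weakly convergent sequences as well as along strongly
convergent sequences; in particular recovery sequences converge strongly. -/
def IsGammaLimit {L : ℝ} (F : ℕ → H2 L × H1 L → EReal) (F₀ : H2 L × H1 L → EReal) : Prop :=
  GammaConv WeakConv F F₀ ∧ GammaConv StrongConv F F₀

end Ribbon

end

open MeasureTheory Filter Topology Set
open scoped ContDiff

noncomputable section

namespace Ribbon

/-! ### Primitives of square integrable functions -/

section Primitive

variable {L : ℝ}

/-! The argument rests on two facts: the energy is the square of a continuous seminorm, and smooth
admissible frames are dense among admissible ones.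

For `α, β ≥ 0` the root `√(Qbar α β)` is the maximum over `s ∈ [0, 1]` of `(1 - s²) α + 2 s β`. It
is therefore monotone, subadditive and positively homogeneous, and `√E` is a seminorm on `H² × H¹`
(`energySeminorm`) bounded by the norm. So `E` is strongly continuous and, by Hahn-Banach, weakly
lower semicontinuous. Moreover `Qreg` differs from `Qbar` by at most `5/2 · cuni · δ`, uniformly in
`α` and `β`, so the regularization only adds an error `O(δ)`.

Point values of `y`, `y'`, `b` are continuous linear in the frame. Hence they converge along weakly
convergent sequences, the admissible set is weakly closed, and the unit tangents converge boundedly.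
Pairing strongly convergent tangents with weakly convergent `b'` makes the shear weakly lower
semicontinuous (`WeakConv.eventually_lt_shearSq`). Both lower bounds follow; constant sequences
serve as recovery sequences.

For the density (`exists_smooth_admissible_near`), `y'` and `b` are replaced by smooth curves with
the same end values, and the Gram-Schmidt process restores orthonormality without changing the end
values. What may break is `y(L)`, that is, the integral of the normalized tangent. It is repaired by
adding `bump • s` with a small `s ∈ ℝ³` (`exists_correction`). The derivative of the integral in `s`
averages the projections onto the planes orthogonal to `y'`, so it is invertible unless `y'` is
constant, and then no correction is needed. The approximants need not be unshearable, but strong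
convergence sends their shear to zero (`StrongConv.tendsto_shearSq`). -/

theorem integrable_coe (v : L2 L) : Integrable v (vol L) :=
  (Lp.memLp v).integrable (by norm_num)

theorem integrable_indicator (v : L2 L) : Integrable ((Ioo 0 L).indicator v) :=
  (integrable_indicator_iff measurableSet_Ioo).2 (integrable_coe v)

/-- The primitive of `v ∈ L²(0, L; ℝ³)`, extended by zero to the real line, that vanishes at `0`. -/
def prim (v : L2 L) (x : ℝ) : E3 := ∫ t in (0 : ℝ)..x, (Ioo 0 L).indicator v t

theorem continuous_prim (v : L2 L) : Continuous (prim v) :=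
  intervalIntegral.continuous_primitive (fun _ _ => (integrable_indicator v).intervalIntegrable) 0

@[simp] theorem prim_zero (v : L2 L) : prim v 0 = 0 := intervalIntegral.integral_same

theorem indicator_congr {f g : ℝ → E3} (h : f =ᵐ[vol L] g) :
    (Ioo 0 L).indicator f =ᵐ[volume] (Ioo 0 L).indicator g :=
  (ae_eq_restrict_iff_indicator_ae_eq measurableSet_Ioo).1 h

theorem prim_eq_integral_indicator {f : ℝ → E3} {v : L2 L} (h : v =ᵐ[vol L] f) (x : ℝ) :
    prim v x = ∫ t in (0 : ℝ)..x, (Ioo 0 L).indicator f t :=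
  intervalIntegral.integral_congr_ae ((indicator_congr h).mono fun _ h _ => h)

theorem prim_eq_integral {f : ℝ → E3} {v : L2 L} (h : v =ᵐ[vol L] f) {x : ℝ}
    (hx : x ∈ Icc 0 L) : prim v x = ∫ t in (0 : ℝ)..x, f t := by
  rw [prim_eq_integral_indicator h, intervalIntegral.integral_of_le hx.1,
    intervalIntegral.integral_of_le hx.1, integral_Ioc_eq_integral_Ioo, integral_Ioc_eq_integral_Ioo]
  refine setIntegral_congr_fun measurableSet_Ioo fun t ht => ?_
  exact indicator_of_mem (show t ∈ Ioo 0 L from ⟨ht.1, ht.2.trans_le hx.2⟩) _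

theorem prim_add (u v : L2 L) (x : ℝ) : prim (u + v) x = prim u x + prim v x := by
  rw [prim_eq_integral_indicator (Lp.coeFn_add u v), prim, prim, ← intervalIntegral.integral_add
    (integrable_indicator u).intervalIntegrable (integrable_indicator v).intervalIntegrable]
  simp only [indicator_add']
  rfl

theorem prim_smul (c : ℝ) (v : L2 L) (x : ℝ) : prim (c • v) x = c • prim v x := by
  rw [prim_eq_integral_indicator (Lp.coeFn_smul c v), prim, ← intervalIntegral.integral_smul]
  refine intervalIntegral.integral_congr fun t _ => ?_
  exact indicator_const_smul_apply _ c v t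

/-- Cauchy-Schwarz against the constant `1`; `max L 0` is the length of the interval without a sign
condition on `L`. -/
theorem integral_norm_le (v : L2 L) : ∫ t in Ioo 0 L, ‖v t‖ ≤ √(max L 0) * ‖v‖ := by
  have h2 := integral_mul_le_Lp_mul_Lq_of_nonneg (μ := vol L) (f := fun _ => (1 : ℝ))
    (g := fun t => ‖v t‖) Real.HolderConjugate.two_two (Eventually.of_forall fun _ => zero_le_one)
    (Eventually.of_forall fun _ => norm_nonneg _) (memLp_const _)
    (by simpa using (Lp.memLp v).norm)
  have h3 : ‖v‖ = (∫ t in Ioo 0 L, ‖v t‖ ^ (2 : ℝ)) ^ (1 / (2 : ℝ)) := by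
    rw [Lp.norm_def v, (Lp.memLp v).eLpNorm_eq_integral_rpow_norm (by norm_num) (by norm_num),
      ENNReal.toReal_ofReal (by positivity)]
    simp
  rw [h3]
  simpa [Real.sqrt_eq_rpow, Measure.real, ENNReal.toReal_ofReal'] using h2

theorem norm_prim_le (v : L2 L) (x : ℝ) : ‖prim v x‖ ≤ √(max L 0) * ‖v‖ := by
  refine le_trans ?_ (integral_norm_le v)
  refine intervalIntegral.norm_integral_le_integral_norm_uIoc.trans ?_
  refine (setIntegral_le_integral (integrable_indicator v).norm
    (Eventually.of_forall fun _ => norm_nonneg _)).trans_eq ?_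
  rw [← integral_indicator measurableSet_Ioo]
  simp only [norm_indicator_eq_indicator_norm]

/-- The value at `x` of the primitive, as a continuous linear map. -/
def primAt (L x : ℝ) : L2 L →L[ℝ] E3 :=
  LinearMap.mkContinuous ⟨⟨fun v => prim v x, fun u v => prim_add u v x⟩,
    fun c v => prim_smul c v x⟩ (√(max L 0)) fun v => norm_prim_le v x

@[simp] theorem primAt_apply (x : ℝ) (v : L2 L) : primAt L x v = prim v x := rfl

theorem memLp_of_continuous {E : Type*} [NormedAddCommGroup E] {f : ℝ → E}
    (hf : ContinuousOn f (Icc 0 L)) (p : ENNReal) : MemLp f p (vol L) := by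
  obtain ⟨C, hC⟩ := isCompact_Icc.exists_bound_of_continuousOn hf
  refine MemLp.of_bound ((hf.mono Ioo_subset_Icc_self).aestronglyMeasurable measurableSet_Ioo) C ?_
  filter_upwards [ae_restrict_mem measurableSet_Ioo] with x hx using hC x (Ioo_subset_Icc_self hx)

theorem memLp_prim (v : L2 L) : MemLp (prim v) 2 (vol L) :=
  memLp_of_continuous (continuous_prim v).continuousOn 2

/-- The primitive that vanishes at `0`, as an element of `L²`. -/
def primLp (L : ℝ) : L2 L →L[ℝ] L2 L :=
  LinearMap.mkContinuous
    ⟨⟨fun v => (memLp_prim v).toLp (prim v), fun u v =>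
        (MemLp.toLp_congr _ ((memLp_prim u).add (memLp_prim v))
          (Eventually.of_forall fun x => prim_add u v x)).trans (MemLp.toLp_add _ _)⟩,
      fun c v =>
        (MemLp.toLp_congr (memLp_prim (c • v)) ((memLp_prim v).const_smul c)
          (Eventually.of_forall fun x => prim_smul c v x)).trans
          (MemLp.toLp_const_smul c (memLp_prim v))⟩
    ((measureUnivNNReal (vol L) : ℝ) ^ (2 : ENNReal).toReal⁻¹ * √(max L 0)) fun v => by
      rw [mul_assoc]
      refine Lp.norm_le_of_ae_bound (by positivity) ?_
      filter_upwards [MemLp.coeFn_toLp (memLp_prim v)] with x hx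
      exact (congrArg norm hx).trans_le (norm_prim_le v x)

theorem coeFn_primLp (v : L2 L) : primLp L v =ᵐ[vol L] prim v :=
  MemLp.coeFn_toLp (memLp_prim v)

theorem ae_hasDerivAt_prim (v : L2 L) : ∀ᵐ x ∂(vol L), HasDerivAt (prim v) (v x) x := by
  have h := LocallyIntegrable.ae_hasDerivAt_integral (integrable_indicator v).locallyIntegrable
  filter_upwards [ae_restrict_of_ae h, ae_restrict_mem measurableSet_Ioo] with x hx hx'
  simpa [indicator_of_mem hx'] using! hx 0

theorem prim_hasDerivAt {f : ℝ → E3} (hf : Continuous f) {v : L2 L} (h : v =ᵐ[vol L] f) {x : ℝ}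
    (hx : x ∈ Ioo 0 L) : HasDerivAt (prim v) (f x) x := by
  have h1 : HasDerivAt (fun x => ∫ t in (0 : ℝ)..x, f t) (f x) x :=
    intervalIntegral.integral_hasDerivAt_right (hf.intervalIntegrable _ _)
      (hf.stronglyMeasurableAtFilter _ _) hf.continuousAt
  refine h1.congr_of_eventuallyEq ?_
  filter_upwards [Icc_mem_nhds hx.1 hx.2] with y hy using prim_eq_integral h hy

end Primitive

/-! ### Weak derivatives in one dimension -/

section WeakDerivative

variable {L : ℝ}

theorem continuous_integral_smul {ψ : ℝ → ℝ} (hψ : Continuous ψ) (hc : HasCompactSupport ψ) :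
    Continuous fun v : L2 L => ∫ x in Ioo 0 L, ψ x • v x := by
  obtain ⟨C, hC⟩ := hc.exists_bound_of_continuous hψ
  refine (LipschitzWith.of_dist_le_mul (K := Real.toNNReal (C * √(max L 0))) fun u v => ?_).continuous
  have hC0 : 0 ≤ C := (norm_nonneg _).trans (hC 0)
  rw [Real.coe_toNNReal _ (by positivity), dist_eq_norm, dist_eq_norm,
    ← integral_sub (integrable_smul u hψ hc) (integrable_smul v hψ hc), mul_assoc]
  refine le_trans ?_ (mul_le_mul_of_nonneg_left (integral_norm_le (u - v)) hC0)
  rw [← integral_const_mul]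
  refine norm_integral_le_of_norm_le ((integrable_coe (u - v)).norm.const_mul C) ?_
  filter_upwards [Lp.coeFn_sub u v] with x hx
  rw [hx, ← smul_sub, norm_smul, Pi.sub_apply]
  exact mul_le_mul_of_nonneg_right (hC x) (norm_nonneg _)

theorem IsTest.eq_zero {φ : ℝ → ℝ} (h : IsTest L φ) {x : ℝ} (hx : x ∉ Ioo 0 L) : φ x = 0 :=
  image_eq_zero_of_notMem_tsupport fun h' => hx (h.support h')

/-- A primitive of `v` has the weak derivative `v`. -/
theorem isWeakDeriv_primLp (hL : 0 < L) (v : L2 L) : IsWeakDeriv L (primLp L v) v := by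
  intro φ hφ
  have hcl : IsClosed {v : L2 L | ∫ x in Ioo 0 L, deriv φ x • primLp L v x
      = -∫ x in Ioo 0 L, φ x • v x} :=
    isClosed_eq ((continuous_integral_smul hφ.continuous_deriv hφ.compact.deriv).comp
      (primLp L).continuous) (continuous_integral_smul hφ.smooth.continuous hφ.compact).neg
  -- Both sides are continuous in `v`, so it suffices to treat smooth `v`, where classical
  -- integration by parts applies.
  refine hcl.closure_subset_iff.2 ?_
    (Lp.dense_hasCompactSupport_contDiff (μ := vol L) (p := 2) (F := E3) (by norm_num) v)
  rintro v ⟨f, hf, -, hfs⟩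
  have hcf : Continuous f := hfs.continuous
  have h1 := intervalIntegral.integral_smul_deriv_eq_deriv_smul_of_hasDerivAt (a := 0) (b := L)
    (u := φ) (v := prim v) (u' := deriv φ) (v' := f)
    hφ.smooth.continuous.continuousOn (continuous_prim v).continuousOn
    (fun x _ => (hφ.smooth.differentiable (by simp) x).hasDerivAt)
    (fun x hx => prim_hasDerivAt hcf hf (by simpa [hL.le] using hx))
    (hφ.continuous_deriv.intervalIntegrable _ _) (hcf.intervalIntegrable _ _)
  rw [hφ.eq_zero (by simp), hφ.eq_zero (by simp), zero_smul, zero_smul, sub_zero, zero_sub,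
    intervalIntegral.integral_of_le hL.le, intervalIntegral.integral_of_le hL.le,
    integral_Ioc_eq_integral_Ioo, integral_Ioc_eq_integral_Ioo] at h1
  have h2 : ∫ x in Ioo 0 L, φ x • v x = ∫ x in Ioo 0 L, φ x • f x :=
    integral_congr_ae (hf.mono fun x hx => by simp only [hx])
  have h3 : ∫ x in Ioo 0 L, deriv φ x • primLp L v x = ∫ x in Ioo 0 L, deriv φ x • prim v x :=
    integral_congr_ae ((coeFn_primLp v).mono fun x hx => by simp only [hx])
  rw [mem_ofPred_eq, h2, h3, h1, neg_neg]

/-- A test function with vanishing integral is the derivative of a test function. -/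
theorem IsTest.exists_primitive {ψ : ℝ → ℝ} (h : IsTest L ψ) (h0 : ∫ x, ψ x = 0) :
    ∃ φ, IsTest L φ ∧ deriv φ = ψ := by
  have hc := h.smooth.continuous
  set φ : ℝ → ℝ := fun x => ∫ t in Iic x, ψ t with hφ
  have hint : Integrable ψ := hc.integrable_of_hasCompactSupport h.compact
  have hder : ∀ x, HasDerivAt φ (ψ x) x := by
    intro x
    have h1 : HasDerivAt (fun y => (∫ t in Iic (0 : ℝ), ψ t) + ∫ t in (0 : ℝ)..y, ψ t) (ψ x) x :=
      (intervalIntegral.integral_hasDerivAt_right (hc.intervalIntegrable _ _)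
        (hc.stronglyMeasurableAtFilter _ _) hc.continuousAt).const_add _
    convert h1 using 2 with y
    rw [← intervalIntegral.integral_Iic_sub_Iic hint.integrableOn hint.integrableOn]
    ring
  have hd : deriv φ = ψ := funext fun x => (hder x).deriv
  -- If the support is empty, the empty interval `[1, 0]` serves.
  obtain ⟨a, b, hab, hsub⟩ : ∃ a b, Icc a b ⊆ Ioo 0 L ∧ tsupport ψ ⊆ Icc a b := by
    rcases (tsupport ψ).eq_empty_or_nonempty with he | hne
    · exact ⟨1, 0, by simp, by simp [he]⟩
    · have hK : IsCompact (tsupport ψ) := h.compact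
      refine ⟨sInf (tsupport ψ), sSup (tsupport ψ), fun x hx => ?_, fun x hx =>
        ⟨csInf_le hK.bddBelow hx, le_csSup hK.bddAbove hx⟩⟩
      exact ⟨(h.support (hK.sInf_mem hne)).1.trans_le hx.1,
        hx.2.trans_lt (h.support (hK.sSup_mem hne)).2⟩
  -- To the left of the support nothing has been integrated yet; to the right the whole integral,
  -- which is zero.
  have hz : ∀ x, x ∉ Icc a b → φ x = 0 := by
    intro x hx
    rw [mem_Icc, not_and_or, not_le, not_le] at hx
    have hψ : ∀ t, t ∉ Icc a b → ψ t = 0 := fun t ht =>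
      image_eq_zero_of_notMem_tsupport fun h' => ht (hsub h')
    rcases hx with hx | hx
    · refine setIntegral_eq_zero_of_forall_eq_zero fun t ht => hψ t fun h' => ?_
      exact absurd (h'.1.trans ht) (not_le.2 hx)
    · rw [← h0]
      refine setIntegral_eq_integral_of_forall_compl_eq_zero fun t ht => hψ t fun h' => ht ?_
      exact h'.2.trans hx.le
  have hts : tsupport φ ⊆ Icc a b :=
    closure_minimal (fun x hx => by_contra fun h' => hx (hz x h')) isClosed_Icc
  refine ⟨φ, ⟨?_, HasCompactSupport.intro isCompact_Icc hz, hts.trans hab⟩, hd⟩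
  rw [contDiff_infty_iff_deriv]
  exact ⟨fun x => (hder x).differentiableAt, hd ▸ h.smooth⟩

theorem exists_isTest_integral_eq_one (hL : 0 < L) : ∃ η : ℝ → ℝ, IsTest L η ∧ ∫ x, η x = 1 := by
  let f : ContDiffBump (L / 2) := ⟨L / 8, L / 4, by linarith, by linarith⟩
  refine ⟨f.normed volume, ⟨f.contDiff_normed, f.hasCompactSupport_normed, ?_⟩,
    f.integral_normed⟩
  rw [f.tsupport_normed_eq, Real.closedBall_eq_Icc]
  intro x hx
  change L / 2 - L / 4 ≤ x ∧ x ≤ L / 2 + L / 4 at hx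
  constructor <;> linarith [hx.1, hx.2]

/-- The du Bois-Reymond lemma. -/
theorem exists_ae_eq_const (hL : 0 < L) {w : L2 L}
    (hw : ∀ φ, IsTest L φ → ∫ x in Ioo 0 L, deriv φ x • w x = 0) :
    ∃ c : E3, w =ᵐ[vol L] fun _ => c := by
  obtain ⟨η, hη, hη1⟩ := exists_isTest_integral_eq_one hL
  refine ⟨∫ x in Ioo 0 L, η x • w x, ?_⟩
  set c := ∫ x in Ioo 0 L, η x • w x with hc
  have hset : ∀ ψ : ℝ → ℝ, IsTest L ψ → ∫ x in Ioo 0 L, ψ x = ∫ x, ψ x := fun ψ hψ =>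
    setIntegral_eq_integral_of_forall_compl_eq_zero fun x hx => hψ.eq_zero hx
  have h1 : LocallyIntegrableOn (fun x => w x - c) (Ioo 0 L) volume :=
    IntegrableOn.locallyIntegrableOn ((integrable_coe w).sub (integrable_const c))
  have h2 := isOpen_Ioo.ae_eq_zero_of_integral_contDiff_smul_eq_zero h1 fun ψ hψs hψc hψt => by
    have hψ : IsTest L ψ := ⟨hψs, hψc, hψt⟩
    have hi : ∀ χ : ℝ → ℝ, IsTest L χ → Integrable (fun x => χ x • w x) (vol L) :=
      fun χ hχ => integrable_smul w hχ.smooth.continuous hχ.compact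
    -- Subtracting the multiple of `η` with the same integral leaves a function of mean zero, hence
    -- the derivative of a test function.
    have hζ : IsTest L fun x => ψ x - (∫ y, ψ y) * η x :=
      ⟨hψs.sub (contDiff_const.mul hη.smooth), hψc.sub hη.compact.mul_left,
        (tsupport_sub _ _).trans (union_subset hψt
          ((tsupport_mul_subset_right).trans hη.support))⟩
    have hψi : Integrable ψ := hψs.continuous.integrable_of_hasCompactSupport hψc
    have hηi : Integrable η := hη.smooth.continuous.integrable_of_hasCompactSupport hη.compact
    obtain ⟨φ, hφ, hφd⟩ := hζ.exists_primitive (by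
      rw [integral_sub hψi (hηi.const_mul _), integral_const_mul, hη1, mul_one, sub_self])
    have h3 := hw φ hφ
    simp only [hφd, sub_smul, mul_smul] at h3
    have h4 : Integrable (fun x => (∫ y, ψ y) • η x • w x) (vol L) := (hi η hη).fun_smul _
    rw [integral_sub (hi ψ hψ) h4, integral_smul, sub_eq_zero] at h3
    rw [← setIntegral_eq_integral_of_forall_compl_eq_zero (s := Ioo 0 L)
      fun x hx => by rw [hψ.eq_zero hx, zero_smul]]
    simp only [smul_sub]
    rw [integral_sub (hi ψ hψ) ((hψi.mono_measure Measure.restrict_le_self).smul_const c), h3,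
      integral_smul_const, hset ψ hψ, sub_self]
  filter_upwards [(ae_restrict_iff' measurableSet_Ioo).2 h2] with x hx
  exact sub_eq_zero.1 hx

end WeakDerivative

/-! ### Continuous representatives and the Sobolev spaces -/

section Representatives

variable {L : ℝ}

theorem IsWeakDeriv.of_ae_eq (hL : 0 < L) {u v : L2 L} (c : E3)
    (h : u =ᵐ[vol L] fun x => c + prim v x) : IsWeakDeriv L u v := by
  intro φ hφ
  rw [← isWeakDeriv_primLp hL v φ hφ]
  have h0 : ∫ x in Ioo 0 L, deriv φ x = 0 := by
    rw [← integral_Ioc_eq_integral_Ioo, ← intervalIntegral.integral_of_le hL.le,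
      intervalIntegral.integral_deriv_eq_sub (fun x _ => hφ.smooth.differentiable (by simp) x)
        (hφ.continuous_deriv.intervalIntegrable _ _), hφ.eq_zero (by simp), hφ.eq_zero (by simp),
      sub_zero]
  have hi : Integrable (deriv φ) (vol L) :=
    (hφ.continuous_deriv.integrable_of_hasCompactSupport hφ.compact.deriv).mono_measure
      Measure.restrict_le_self
  have h1 : ∫ x in Ioo 0 L, deriv φ x • u x
      = ∫ x in Ioo 0 L, (deriv φ x • c + deriv φ x • primLp L v x) := by
    refine integral_congr_ae ?_
    filter_upwards [h, coeFn_primLp v] with x hx hx'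
    rw [hx, hx', smul_add]
  rw [h1, integral_add (hi.smul_const c)
    (integrable_smul _ hφ.continuous_deriv hφ.compact.deriv), integral_smul_const, h0, zero_smul,
    zero_add]

/-- The value at `x` of the continuous representative of `u`, when `v` is the weak derivative
of `u`. -/
def crepAt (L x : ℝ) : L2 L × L2 L →L[ℝ] E3 :=
  -- If `v` is the weak derivative of `u`, then `u` minus the primitive of `v` is a constant,
  -- recovered here as its mean. This form makes the point value continuous and linear in `(u, v)`.
  L⁻¹ • (primAt L L).comp (ContinuousLinearMap.fst ℝ _ _ -
    (primLp L).comp (ContinuousLinearMap.snd ℝ _ _)) +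
    (primAt L x).comp (ContinuousLinearMap.snd ℝ _ _)

/-- The continuous representative of `u`, when `v` is the weak derivative of `u`. -/
def crep (u v : L2 L) (x : ℝ) : E3 := crepAt L x (u, v)

theorem crep_eq (u v : L2 L) (x : ℝ) : crep u v x = crep u v 0 + prim v x := by
  simp [crep, crepAt]

theorem continuous_crep (u v : L2 L) : Continuous (crep u v) := by
  rw [funext (crep_eq u v)]
  exact continuous_const.add (continuous_prim v)

theorem ae_hasDerivAt_crep (u v : L2 L) : ∀ᵐ x ∂(vol L), HasDerivAt (crep u v) (v x) x := by
  filter_upwards [ae_hasDerivAt_prim v] with x hx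
  rw [funext (crep_eq u v)]
  exact hx.const_add _

theorem crep_of_ae_eq (hL : 0 < L) {u v : L2 L} {c : E3}
    (h : u =ᵐ[vol L] fun x => c + prim v x) (x : ℝ) : crep u v x = c + prim v x := by
  have h1 : (u - primLp L v : L2 L) =ᵐ[vol L] fun _ => c := by
    filter_upwards [h, coeFn_primLp v, Lp.coeFn_sub u (primLp L v)] with x h1 h2 h3
    rw [h3, Pi.sub_apply, h1, h2, add_sub_cancel_right]
  have h2 : prim (u - primLp L v) L = L • c := by
    rw [prim_eq_integral h1 ⟨hL.le, le_rfl⟩, intervalIntegral.integral_const, sub_zero]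
  have h3 : crep u v x = L⁻¹ • prim (u - primLp L v) L + prim v x := rfl
  rw [h3, h2, smul_smul, inv_mul_cancel₀ hL.ne', one_smul]

theorem IsWeakDeriv.ae_eq_crep (hL : 0 < L) {u v : L2 L} (h : IsWeakDeriv L u v) :
    u =ᵐ[vol L] crep u v := by
  obtain ⟨c, hc⟩ := exists_ae_eq_const hL (w := u - primLp L v) fun φ hφ => by
    have h1 : ∫ x in Ioo 0 L, deriv φ x • (u - primLp L v : L2 L) x =
        ∫ x in Ioo 0 L, (deriv φ x • u x - deriv φ x • primLp L v x) := by
      refine integral_congr_ae ?_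
      filter_upwards [Lp.coeFn_sub u (primLp L v)] with x hx
      rw [hx, Pi.sub_apply, smul_sub]
    rw [h1, integral_sub (integrable_smul _ hφ.continuous_deriv hφ.compact.deriv)
      (integrable_smul _ hφ.continuous_deriv hφ.compact.deriv), h φ hφ,
      isWeakDeriv_primLp hL v φ hφ, sub_self]
  have h2 : u =ᵐ[vol L] fun x => c + prim v x := by
    filter_upwards [hc, coeFn_primLp v, Lp.coeFn_sub u (primLp L v)] with x h1 h2 h3
    rw [h3, Pi.sub_apply, h2, sub_eq_iff_eq_add] at h1
    exact h1
  exact h2.trans (Eventually.of_forall fun x => (crep_of_ae_eq hL h2 x).symm)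

theorem ae_vol_iff_Icc {P : ℝ → Prop} :
    (∀ᵐ x ∂(vol L), P x) ↔ ∀ᵐ x ∂(volume.restrict (Icc 0 L)), P x := by
  rw [vol, Measure.restrict_congr_set Ioo_ae_eq_Icc]

theorem eqOn_Icc_of_ae_eq (hL : 0 < L) {Y : Type*} [TopologicalSpace Y] [T2Space Y] {f g : ℝ → Y}
    (h : f =ᵐ[vol L] g) (hf : ContinuousOn f (Icc 0 L)) (hg : ContinuousOn g (Icc 0 L)) :
    EqOn f g (Icc 0 L) :=
  Measure.eqOn_Icc_of_ae_eq volume hL.ne (ae_vol_iff_Icc.1 h) hf hg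

theorem IsContRep.eqOn (hL : 0 < L) {u : L2 L} {f g : ℝ → E3} (hf : IsContRep L u f)
    (hg : IsContRep L u g) : EqOn f g (Icc 0 L) :=
  eqOn_Icc_of_ae_eq hL (hf.2.symm.trans hg.2) hf.1 hg.1

theorem isWeakDeriv_zero_H2 (y : H2 L) : IsWeakDeriv L (D 0 y) (D 1 y) := y.2 0

theorem isWeakDeriv_one_H2 (y : H2 L) : IsWeakDeriv L (D 1 y) (D 2 y) := y.2 1

theorem isWeakDeriv_H1 (b : H1 L) : IsWeakDeriv L (D 0 b) (D 1 b) := b.2 0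

/-- The weak derivative as a continuous linear map. -/
def Dclm (L : ℝ) {k : ℕ} (j : Fin (k + 1)) : sobolev L k →L[ℝ] L2 L :=
  (PiLp.proj 2 (fun _ : Fin (k + 1) => L2 L) j).comp (sobolev L k).subtypeL

@[simp] theorem Dclm_apply {k : ℕ} (j : Fin (k + 1)) (u : sobolev L k) : Dclm L j u = D j u := rfl

theorem norm_D_le {k : ℕ} (j : Fin (k + 1)) (u : sobolev L k) : ‖D j u‖ ≤ ‖u‖ :=
  PiLp.norm_apply_le (u : PiLp 2 (fun _ : Fin (k + 1) => L2 L)) j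

theorem tendsto_sobolev {k : ℕ} {ι : Type*} {l : Filter ι} {u : ι → sobolev L k}
    {u₀ : sobolev L k} (h : ∀ j, Tendsto (fun i => D j (u i)) l (𝓝 (D j u₀))) :
    Tendsto u l (𝓝 u₀) := by
  rw [tendsto_subtype_rng]
  have h1 := tendsto_pi_nhds.2 h
  exact (PiLp.continuous_toLp 2 (fun _ : Fin (k + 1) => L2 L)).continuousAt.tendsto.comp h1

/-- The function with the value `c` at `0` and the derivative `v`. -/
def affPrim (c : E3) (v : L2 L) : L2 L := Lp.const 2 (vol L) c + primLp L v

theorem coeFn_affPrim (c : E3) (v : L2 L) : affPrim c v =ᵐ[vol L] fun x => c + prim v x := by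
  filter_upwards [Lp.coeFn_add (Lp.const 2 (vol L) c) (primLp L v), coeFn_primLp v,
    Lp.coeFn_const (p := 2) (μ := vol L) c] with x h1 h2 h3
  exact h1.trans (by rw [Pi.add_apply, h2, h3, Function.const_apply])

theorem continuous_affPrim (c : E3) : Continuous (affPrim (L := L) c) :=
  continuous_const.add (primLp L).continuous

theorem isWeakDeriv_affPrim (hL : 0 < L) (c : E3) (v : L2 L) : IsWeakDeriv L (affPrim c v) v :=
  IsWeakDeriv.of_ae_eq hL c (coeFn_affPrim c v)

theorem IsWeakDeriv.eq_affPrim (hL : 0 < L) {u v : L2 L} (h : IsWeakDeriv L u v) :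
    u = affPrim (crep u v 0) v := by
  refine Lp.ext ((h.ae_eq_crep hL).trans ?_)
  filter_upwards [coeFn_affPrim (crep u v 0) v] with x hx
  rw [hx, crep_eq]

theorem crep_affPrim (hL : 0 < L) (c : E3) (v : L2 L) (x : ℝ) :
    crep (affPrim c v) v x = c + prim v x :=
  crep_of_ae_eq hL (coeFn_affPrim c v) x

/-- The element of `H¹` with the value `c` at `0` and the derivative `v`. -/
def mkH1 (hL : 0 < L) (c : E3) (v : L2 L) : H1 L :=
  ⟨WithLp.toLp 2 ![affPrim c v, v], by
    intro j
    fin_cases j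
    exact isWeakDeriv_affPrim hL c v⟩

/-- The element of `H²` with the value `c` and the derivative `d` at `0` and the second
derivative `v`. -/
def mkH2 (hL : 0 < L) (c d : E3) (v : L2 L) : H2 L :=
  ⟨WithLp.toLp 2 ![affPrim c (affPrim d v), affPrim d v, v], by
    intro j
    fin_cases j
    · exact isWeakDeriv_affPrim hL c _
    · exact isWeakDeriv_affPrim hL d v⟩

/-- With the value at `0` held fixed, convergence of the top derivative alone gives convergence in
the full norm, since taking primitives is continuous on `L²`. -/
theorem tendsto_mkH1 (hL : 0 < L) (b : H1 L) {ι : Type*} {l : Filter ι} {v : ι → L2 L}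
    (hv : Tendsto v l (𝓝 (D 1 b))) :
    Tendsto (fun i => mkH1 hL (crep (D 0 b) (D 1 b) 0) (v i)) l (𝓝 b) := by
  have h0 : Tendsto (fun i => affPrim (crep (D 0 b) (D 1 b) 0) (v i)) l (𝓝 (D 0 b)) := by
    have := ((continuous_affPrim (crep (D 0 b) (D 1 b) 0)).tendsto _).comp hv
    rwa [← (isWeakDeriv_H1 b).eq_affPrim hL] at this
  refine tendsto_sobolev fun j => ?_
  fin_cases j
  · exact h0
  · exact hv

theorem tendsto_mkH2 (hL : 0 < L) (y : H2 L) {ι : Type*} {l : Filter ι} {v : ι → L2 L}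
    (hv : Tendsto v l (𝓝 (D 2 y))) :
    Tendsto (fun i => mkH2 hL (crep (D 0 y) (D 1 y) 0) (crep (D 1 y) (D 2 y) 0) (v i)) l
      (𝓝 y) := by
  have h1 : Tendsto (fun i => affPrim (crep (D 1 y) (D 2 y) 0) (v i)) l (𝓝 (D 1 y)) := by
    have := ((continuous_affPrim (crep (D 1 y) (D 2 y) 0)).tendsto _).comp hv
    rwa [← (isWeakDeriv_one_H2 y).eq_affPrim hL] at this
  have h0 : Tendsto (fun i => affPrim (crep (D 0 y) (D 1 y) 0)
      (affPrim (crep (D 1 y) (D 2 y) 0) (v i))) l (𝓝 (D 0 y)) := by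
    have := ((continuous_affPrim (crep (D 0 y) (D 1 y) 0)).tendsto _).comp h1
    rwa [← (isWeakDeriv_zero_H2 y).eq_affPrim hL] at this
  refine tendsto_sobolev fun j => ?_
  fin_cases j
  · exact h0
  · exact h1
  · exact hv

end Representatives

/-! ### The energy densities -/

section Density

/-- The closed form of the energy density. -/
theorem Qbar_eq (α β : ℝ) : Qbar α β = 2 * β ^ 2 + 1 / 2 * α ^ 2 + 1 / 2 * β ^ 2
    + 1 / 2 * |α ^ 2 - β ^ 2| + 2 * β ^ 4 / (α ^ 2 + β ^ 2 + |α ^ 2 - β ^ 2|) := by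
  unfold Qbar
  split_ifs with h
  · have h1 : β ^ 2 ≤ α ^ 2 := sq_le_sq.2 h
    rw [abs_of_nonneg (sub_nonneg.2 h1)]
    rcases eq_or_ne α 0 with rfl | hα
    · have : β = 0 := by simpa using h
      simp [this]
    · have h2 : α ^ 2 + β ^ 2 + (α ^ 2 - β ^ 2) = 2 * α ^ 2 := by ring
      rw [h2]
      field_simp
      ring
  · have h1 : α ^ 2 < β ^ 2 := sq_lt_sq.2 (not_le.1 h)
    have hβ : β ≠ 0 := by
      rintro rfl
      exact (not_lt.2 (sq_nonneg α)) (by simpa using h1)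
    rw [abs_of_neg (sub_neg.2 h1)]
    have h2 : α ^ 2 + β ^ 2 + -(α ^ 2 - β ^ 2) = 2 * β ^ 2 := by ring
    rw [h2]
    field_simp
    ring

theorem Qbar_nonneg (α β : ℝ) : 0 ≤ Qbar α β := by
  unfold Qbar
  split_ifs <;> positivity

theorem measurable_Qbar : Measurable fun z : ℝ × ℝ => Qbar z.1 z.2 := by
  simp only [Qbar_eq, ← Real.norm_eq_abs]
  fun_prop

theorem Qbar_mul (c α β : ℝ) : Qbar (c * α) (c * β) = c ^ 2 * Qbar α β := by
  rcases eq_or_ne c 0 with rfl | hc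
  · simp [Qbar]
  · unfold Qbar
    have h : |c * β| ≤ |c * α| ↔ |β| ≤ |α| := by
      rw [abs_mul, abs_mul, mul_le_mul_iff_right₀ (abs_pos.2 hc)]
    simp only [h]
    split_ifs
    · rcases eq_or_ne α 0 with rfl | hα
      · simp
      · field_simp
    · ring

theorem sqrt_Qbar_of_le {α β : ℝ} (hα : 0 < α) (h : |β| ≤ α) :
    √(Qbar α β) = (α ^ 2 + β ^ 2) / α := by
  rw [Qbar, if_pos (by rwa [abs_of_pos hα]), ← div_pow, Real.sqrt_sq (by positivity)]

theorem sqrt_Qbar_of_lt {α β : ℝ} (hα : 0 ≤ α) (h : α < |β|) : √(Qbar α β) = 2 * |β| := by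
  rw [Qbar, if_neg (by rwa [abs_of_nonneg hα, not_le]), ← sq_abs β,
    show 4 * |β| ^ 2 = (2 * |β|) ^ 2 by ring, Real.sqrt_sq (by positivity)]

/-- Together with `exists_sqrt_Qbar_eq` this presents `√Qbar` on nonnegative arguments as a maximum
of linear functions with nonnegative coefficients. The maximizer is `s = β / α` when `β ≤ α` and `α
≠ 0`, and `s = 1` when `β > α`. -/
theorem le_sqrt_Qbar {α β s : ℝ} (hα : 0 ≤ α) (hs : 0 ≤ s) (hs1 : s ≤ 1) :
    (1 - s ^ 2) * α + 2 * s * β ≤ √(Qbar α β) := by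
  have h3 : 0 ≤ 1 - s ^ 2 := by nlinarith
  rcases le_or_gt |β| α with h | h
  · rcases hα.eq_or_lt with rfl | hα'
    · have : β = 0 := abs_nonpos_iff.1 h
      simp [this]
    · rw [sqrt_Qbar_of_le hα' h, le_div_iff₀ hα']
      -- After multiplication by `α` the gap between the two sides is exactly `(β - s α)²`.
      nlinarith [sq_nonneg (β - s * α)]
  · rw [sqrt_Qbar_of_lt hα h]
    -- Replacing `α` and `β` by `|β|` bounds the left side by `(1 - s² + 2s) |β| = (2 - (1 - s)²)
    -- |β|`.
    nlinarith [mul_le_mul_of_nonneg_left h.le h3, mul_le_mul_of_nonneg_left (le_abs_self β) hs,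
      mul_nonneg (sq_nonneg (1 - s)) (abs_nonneg β)]

theorem exists_sqrt_Qbar_eq {α β : ℝ} (hα : 0 ≤ α) (hβ : 0 ≤ β) :
    ∃ s, 0 ≤ s ∧ s ≤ 1 ∧ √(Qbar α β) = (1 - s ^ 2) * α + 2 * s * β := by
  rcases le_or_gt |β| α with h | h
  · rcases hα.eq_or_lt with rfl | hα'
    · have : β = 0 := abs_nonpos_iff.1 h
      exact ⟨0, le_rfl, zero_le_one, by simp [this, Qbar]⟩
    · refine ⟨β / α, by positivity, (div_le_one hα').2 (by rwa [abs_of_nonneg hβ] at h), ?_⟩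
      rw [sqrt_Qbar_of_le hα' h]
      field_simp
      ring
  · refine ⟨1, zero_le_one, le_rfl, ?_⟩
    rw [sqrt_Qbar_of_lt hα h, abs_of_nonneg hβ]
    ring

/-- The optimal `s` for `(α, β)` is a competitor for both pairs on the right. The hypotheses are
inequalities because the lemma is applied to norms, for which only the triangle inequality is
available. -/
theorem sqrt_Qbar_add_le {α β α₁ β₁ α₂ β₂ : ℝ} (hα : 0 ≤ α) (hβ : 0 ≤ β) (hα₁ : 0 ≤ α₁)
    (hα₂ : 0 ≤ α₂) (h : α ≤ α₁ + α₂) (h' : β ≤ β₁ + β₂) :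
    √(Qbar α β) ≤ √(Qbar α₁ β₁) + √(Qbar α₂ β₂) := by
  obtain ⟨s, hs, hs1, hg⟩ := exists_sqrt_Qbar_eq hα hβ
  have h1 := le_sqrt_Qbar (β := β₁) hα₁ hs hs1
  have h2 := le_sqrt_Qbar (β := β₂) hα₂ hs hs1
  have h3 : 0 ≤ 1 - s ^ 2 := by nlinarith
  have h4 := mul_le_mul_of_nonneg_left h h3
  have h5 := mul_le_mul_of_nonneg_left h' (by positivity : 0 ≤ 2 * s)
  linarith

theorem IsRegModulus.zero {m : ℝ → ℝ → ℝ} {c₀ c₁ c₂ cuni : ℝ}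
    (hm : IsRegModulus m c₀ c₁ c₂ cuni) (x : ℝ) : m 0 x = |x| := by
  have h := hm.uniform 0 le_rfl x
  rw [mul_zero] at h
  exact sub_eq_zero.1 (abs_nonpos_iff.1 h)

theorem IsRegModulus.cuni_nonneg {m : ℝ → ℝ → ℝ} {c₀ c₁ c₂ cuni : ℝ}
    (hm : IsRegModulus m c₀ c₁ c₂ cuni) : 0 ≤ cuni := by
  have h := hm.uniform 1 zero_le_one 0
  linarith [abs_nonneg (m 1 0 - |0|)]

theorem IsRegModulus.measurable {m : ℝ → ℝ → ℝ} {c₀ c₁ c₂ cuni : ℝ}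
    (hm : IsRegModulus m c₀ c₁ c₂ cuni) {δ : ℝ} (hδ : 0 ≤ δ) : Measurable (m δ) := by
  rcases hδ.eq_or_lt with rfl | h
  · rw [funext hm.zero]
    exact measurable_norm
  · exact (hm.contDiff δ h).continuous.measurable

theorem IsRegModulus.Qreg_zero {m : ℝ → ℝ → ℝ} {c₀ c₁ c₂ cuni : ℝ}
    (hm : IsRegModulus m c₀ c₁ c₂ cuni) (α β : ℝ) : Qreg m 0 α β = Qbar α β := by
  rw [Qbar_eq, Qreg, hm.zero]

/-- Of the factor `5/2`, the explicit modulus contributes `1/2` and the fraction `2`: both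
denominators are at least `β²`, which absorbs the `β⁴` in the difference of the fractions. For `β =
0` both fractions vanish, whatever their denominators. -/
theorem IsRegModulus.abs_Qreg_sub_le {m : ℝ → ℝ → ℝ} {c₀ c₁ c₂ cuni : ℝ}
    (hm : IsRegModulus m c₀ c₁ c₂ cuni) {δ : ℝ} (hδ : 0 ≤ δ) (α β : ℝ) :
    |Qreg m δ α β - Qbar α β| ≤ 5 / 2 * (cuni * δ) := by
  rw [Qbar_eq, Qreg]
  have h1 := hm.uniform δ hδ (α ^ 2 - β ^ 2)
  have h2 := hm.nonneg δ hδ (α ^ 2 - β ^ 2)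
  set z := m δ (α ^ 2 - β ^ 2)
  set a := |α ^ 2 - β ^ 2| with ha
  have h3 : 0 ≤ a := abs_nonneg _
  have h4 : |2 * β ^ 4 / (α ^ 2 + β ^ 2 + z) - 2 * β ^ 4 / (α ^ 2 + β ^ 2 + a)| ≤ 2 * |z - a| := by
    rcases eq_or_ne β 0 with rfl | hβ
    · simp
    · have hβ2 : 0 < β ^ 2 := by positivity
      have hz : β ^ 2 ≤ α ^ 2 + β ^ 2 + z := by nlinarith [sq_nonneg α]
      have ha' : β ^ 2 ≤ α ^ 2 + β ^ 2 + a := by nlinarith [sq_nonneg α]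
      have hz0 := hβ2.trans_le hz
      have ha0 := hβ2.trans_le ha'
      rw [div_sub_div _ _ hz0.ne' ha0.ne', abs_div, abs_of_pos (mul_pos hz0 ha0),
        div_le_iff₀ (mul_pos hz0 ha0)]
      have h5 : 2 * β ^ 4 * (α ^ 2 + β ^ 2 + a) - (α ^ 2 + β ^ 2 + z) * (2 * β ^ 4)
        = 2 * β ^ 4 * (a - z) := by ring
      rw [h5, abs_mul, abs_of_nonneg (by positivity : 0 ≤ 2 * β ^ 4), abs_sub_comm a z]
      have h6 : β ^ 4 ≤ (α ^ 2 + β ^ 2 + z) * (α ^ 2 + β ^ 2 + a) := by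
        calc β ^ 4 = β ^ 2 * β ^ 2 := by ring
          _ ≤ _ := mul_le_mul hz ha' hβ2.le hz0.le
      nlinarith [abs_nonneg (z - a)]
  rw [abs_le] at h4 h1 ⊢
  have h7 : |z - a| ≤ cuni * δ := abs_le.2 h1
  constructor <;> linarith

end Density

/-! ### Orthonormal frames -/

/-- The column `p × q` is orthogonal to the other two, and its squared length is also the
determinant; Lagrange's identity `|p × q|² = |p|²|q|² - (p · q)²` makes it `1`. -/
theorem frameMatrix_mem_iff (p q : E3) :
    frameMatrix p q ∈ Matrix.specialOrthogonalGroup (Fin 3) ℝ ↔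
      ‖p‖ = 1 ∧ ‖q‖ = 1 ∧ inner ℝ p q = 0 := by
  have hp : ‖p‖ = 1 ↔ p 0 ^ 2 + p 1 ^ 2 + p 2 ^ 2 = 1 := by
    rw [EuclideanSpace.norm_eq, Real.sqrt_eq_one]
    simp [Fin.sum_univ_three]
  have hq : ‖q‖ = 1 ↔ q 0 ^ 2 + q 1 ^ 2 + q 2 ^ 2 = 1 := by
    rw [EuclideanSpace.norm_eq, Real.sqrt_eq_one]
    simp [Fin.sum_univ_three]
  have hpq : inner ℝ p q = p 0 * q 0 + p 1 * q 1 + p 2 * q 2 := by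
    simp [PiLp.inner_apply, Fin.sum_univ_three]
    ring
  rw [hp, hq, hpq, Matrix.mem_specialOrthogonalGroup_iff, Matrix.mem_orthogonalGroup_iff']
  constructor
  · rintro ⟨h, -⟩
    have h00 := congrFun (congrFun h 0) 0
    have h11 := congrFun (congrFun h 1) 1
    have h01 := congrFun (congrFun h 0) 1
    simp [frameMatrix, Matrix.mul_apply, Fin.sum_univ_three] at h00 h11 h01
    exact ⟨by linarith, by linarith, by linarith⟩
  · rintro ⟨h1, h2, h3⟩
    have h4 : (p 1 * q 2 - p 2 * q 1) ^ 2 + (p 2 * q 0 - p 0 * q 2) ^ 2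
        + (p 0 * q 1 - p 1 * q 0) ^ 2 = 1 := by
      have : (p 1 * q 2 - p 2 * q 1) ^ 2 + (p 2 * q 0 - p 0 * q 2) ^ 2
        + (p 0 * q 1 - p 1 * q 0) ^ 2 = (p 0 ^ 2 + p 1 ^ 2 + p 2 ^ 2) *
        (q 0 ^ 2 + q 1 ^ 2 + q 2 ^ 2) - (p 0 * q 0 + p 1 * q 1 + p 2 * q 2) ^ 2 := by ring
      rw [this, h1, h2, h3]
      norm_num
    constructor
    · ext i j
      fin_cases i <;> fin_cases j <;>
        simp [frameMatrix, Matrix.mul_apply, Fin.sum_univ_three,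
          crossProduct] <;> linarith
    · rw [Matrix.det_fin_three]
      simp [frameMatrix, crossProduct]
      linarith

/-! ### The energy as the square of a seminorm -/

section Energy

variable {L : ℝ}

theorem norm_sq_eq_integral {E : Type*} [NormedAddCommGroup E] [InnerProductSpace ℝ E]
    {μ : Measure ℝ} (v : Lp E 2 μ) : ‖v‖ ^ 2 = ∫ x, ‖v x‖ ^ 2 ∂μ := by
  rw [← real_inner_self_eq_norm_sq, L2.inner_def]
  simp only [real_inner_self_eq_norm_sq]

theorem integrable_norm_sq {E : Type*} [NormedAddCommGroup E] {μ : Measure ℝ} (v : Lp E 2 μ) :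
    Integrable (fun x => ‖v x‖ ^ 2) μ :=
  (memLp_two_iff_integrable_sq_norm (Lp.aestronglyMeasurable v)).1 (Lp.memLp v)

theorem aestronglyMeasurable_Qbar (a b : L2 L) :
    AEStronglyMeasurable (fun x => Qbar ‖a x‖ ‖b x‖) (vol L) :=
  (measurable_Qbar.comp_aemeasurable ((Lp.aestronglyMeasurable a).norm.aemeasurable.prodMk
    (Lp.aestronglyMeasurable b).norm.aemeasurable)).aestronglyMeasurable

theorem sqrt_Qbar_le {α β : ℝ} (hα : 0 ≤ α) (hβ : 0 ≤ β) : √(Qbar α β) ≤ α + 2 * β := by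
  obtain ⟨s, hs, hs1, hg⟩ := exists_sqrt_Qbar_eq hα hβ
  rw [hg]
  nlinarith [mul_nonneg (sq_nonneg s) hα, mul_le_mul_of_nonneg_right hs1 hβ]

theorem memLp_sqrt_Qbar (a b : L2 L) : MemLp (fun x => √(Qbar ‖a x‖ ‖b x‖)) 2 (vol L) := by
  refine MemLp.of_le ((Lp.memLp a).norm.add ((Lp.memLp b).norm.const_mul 2))
    (Real.continuous_sqrt.comp_aestronglyMeasurable (aestronglyMeasurable_Qbar a b))
    (Eventually.of_forall fun x => ?_)
  rw [Real.norm_of_nonneg (Real.sqrt_nonneg _)]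
  exact (sqrt_Qbar_le (norm_nonneg _) (norm_nonneg _)).trans (le_abs_self _)

/-- The square root of the energy density along a pair of `L²` functions. -/
def rootDensity (a b : L2 L) : Lp ℝ 2 (vol L) := (memLp_sqrt_Qbar a b).toLp _

theorem coeFn_rootDensity (a b : L2 L) :
    rootDensity a b =ᵐ[vol L] fun x => √(Qbar ‖a x‖ ‖b x‖) := MemLp.coeFn_toLp _

theorem rootDensity_add_le (a b a' b' : L2 L) :
    ‖rootDensity (a + a') (b + b')‖ ≤ ‖rootDensity a b‖ + ‖rootDensity a' b'‖ := by
  refine le_trans (Lp.norm_le_norm_of_ae_le ?_) (norm_add_le _ _)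
  filter_upwards [coeFn_rootDensity (a + a') (b + b'), coeFn_rootDensity a b,
    coeFn_rootDensity a' b', Lp.coeFn_add a a', Lp.coeFn_add b b',
    Lp.coeFn_add (rootDensity a b) (rootDensity a' b')] with x h1 h2 h3 h4 h5 h6
  rw [h6, h1, Pi.add_apply, h2, h3, h4, h5, Real.norm_of_nonneg (Real.sqrt_nonneg _),
    Real.norm_of_nonneg (add_nonneg (Real.sqrt_nonneg _) (Real.sqrt_nonneg _))]
  exact sqrt_Qbar_add_le (norm_nonneg _) (norm_nonneg _) (norm_nonneg _) (norm_nonneg _)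
    (norm_add_le _ _) (norm_add_le _ _)

theorem rootDensity_smul (c : ℝ) (a b : L2 L) :
    ‖rootDensity (c • a) (c • b)‖ = ‖c‖ * ‖rootDensity a b‖ := by
  rw [← norm_smul]
  have h : ∀ᵐ x ∂(vol L), ‖rootDensity (c • a) (c • b) x‖ = ‖(c • rootDensity a b) x‖ := by
    filter_upwards [coeFn_rootDensity (c • a) (c • b), coeFn_rootDensity a b,
      Lp.coeFn_smul c a, Lp.coeFn_smul c b, Lp.coeFn_smul c (rootDensity a b)] with x h1 h2 h3 h4 h5
    rw [h1, h5, Pi.smul_apply, h2, h3, h4, Pi.smul_apply, Pi.smul_apply, norm_smul, norm_smul,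
      Qbar_mul, norm_smul, Real.norm_eq_abs c, sq_abs, Real.sqrt_mul (sq_nonneg c),
      Real.sqrt_sq_eq_abs, norm_mul, Real.norm_eq_abs, abs_abs, Real.norm_eq_abs]
  exact le_antisymm (Lp.norm_le_norm_of_ae_le (h.mono fun _ h => h.le))
    (Lp.norm_le_norm_of_ae_le (h.mono fun _ h => h.ge))

theorem norm_rootDensity_le (a b : L2 L) : ‖rootDensity a b‖ ≤ ‖a‖ + 2 * ‖b‖ := by
  have h1 : ‖rootDensity a 0‖ ≤ ‖a‖ := by
    refine Lp.norm_le_norm_of_ae_le ?_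
    filter_upwards [coeFn_rootDensity a 0, Lp.coeFn_zero E3 2 (vol L)] with x h1 h2
    rw [h1, h2, Real.norm_of_nonneg (Real.sqrt_nonneg _)]
    simpa using sqrt_Qbar_le (norm_nonneg (a x)) le_rfl
  have h2 : ‖rootDensity 0 b‖ ≤ ‖(2 : ℝ) • b‖ := by
    refine Lp.norm_le_norm_of_ae_le ?_
    filter_upwards [coeFn_rootDensity 0 b, Lp.coeFn_zero E3 2 (vol L),
      Lp.coeFn_smul (2 : ℝ) b] with x h1 h2 h3
    rw [h1, h2, h3, Real.norm_of_nonneg (Real.sqrt_nonneg _), Pi.smul_apply, norm_smul]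
    simpa using sqrt_Qbar_le le_rfl (norm_nonneg (b x))
  have h3 := rootDensity_add_le a 0 0 b
  rw [add_zero, zero_add] at h3
  rw [norm_smul, Real.norm_of_nonneg zero_le_two] at h2
  linarith

theorem norm_rootDensity_sq (a b : L2 L) :
    ‖rootDensity a b‖ ^ 2 = ∫ x in Ioo 0 L, Qbar ‖a x‖ ‖b x‖ := by
  rw [norm_sq_eq_integral]
  refine integral_congr_ae ?_
  filter_upwards [coeFn_rootDensity a b] with x hx
  rw [hx, Real.norm_eq_abs, sq_abs, Real.sq_sqrt (Qbar_nonneg _ _)]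

theorem integrable_Qbar (a b : L2 L) : Integrable (fun x => Qbar ‖a x‖ ‖b x‖) (vol L) := by
  refine (integrable_norm_sq (rootDensity a b)).congr ?_
  filter_upwards [coeFn_rootDensity a b] with x hx
  rw [hx, Real.norm_eq_abs, sq_abs, Real.sq_sqrt (Qbar_nonneg _ _)]

/-- The square root of the energy. -/
def energySeminorm (L : ℝ) : Seminorm ℝ (H2 L × H1 L) :=
  Seminorm.of (fun p => ‖rootDensity (D 2 p.1) (D 1 p.2)‖)
    (fun p q => rootDensity_add_le (D 2 p.1) (D 1 p.2) (D 2 q.1) (D 1 q.2))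
    (fun c p => rootDensity_smul c (D 2 p.1) (D 1 p.2))

theorem energySeminorm_apply (p : H2 L × H1 L) :
    energySeminorm L p = ‖rootDensity (D 2 p.1) (D 1 p.2)‖ := rfl

theorem energySeminorm_sq (p : H2 L × H1 L) : energySeminorm L p ^ 2 = energy p :=
  norm_rootDensity_sq _ _

theorem energySeminorm_le (p : H2 L × H1 L) : energySeminorm L p ≤ 3 * ‖p‖ := by
  have h1 := norm_rootDensity_le (D 2 p.1) (D 1 p.2)
  have h2 := (norm_D_le 2 p.1).trans (norm_fst_le p)
  have h3 := (norm_D_le 1 p.2).trans (norm_snd_le p)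
  rw [energySeminorm_apply]
  linarith

theorem continuous_energySeminorm : Continuous (energySeminorm L) := by
  refine (LipschitzWith.of_dist_le_mul (K := 3) fun p q => ?_).continuous
  rw [Real.dist_eq, dist_eq_norm]
  refine le_trans ?_ (energySeminorm_le (p - q))
  rw [abs_le]
  have h1 := map_add_le_add (energySeminorm L) (p - q) q
  have h2 := map_add_le_add (energySeminorm L) (q - p) p
  rw [sub_add_cancel] at h1 h2
  rw [map_sub_rev] at h2
  constructor <;> linarith

theorem continuous_energy : Continuous (energy (L := L)) := by
  rw [← funext energySeminorm_sq]
  exact continuous_energySeminorm.pow 2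

/-- Sublevel sets of a continuous seminorm are convex and closed, so a continuous functional
strictly separates `x` from `{S ≤ r}`. Weak convergence carries `u n` to the side of `x`. -/
theorem WeakConv.eventually_lt_seminorm {X : Type*} [NormedAddCommGroup X] [NormedSpace ℝ X]
    {S : Seminorm ℝ X} (hS : Continuous S) {u : ℕ → X} {x : X} (h : WeakConv u x) {r : ℝ}
    (hr : r < S x) : ∀ᶠ n in atTop, r < S (u n) := by
  have hconv : Convex ℝ {y | S y ≤ r} := by
    simpa using S.convexOn.convex_le r
  obtain ⟨f, a, ha, hfx⟩ := geometric_hahn_banach_closed_point hconv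
    (isClosed_le hS continuous_const) (not_le.2 hr : ¬ S x ≤ r)
  filter_upwards [(h f).eventually (lt_mem_nhds hfx)] with n hn
  by_contra hc
  exact absurd (ha (u n) (not_lt.1 hc)) (not_lt.2 hn.le)

theorem WeakConv.eventually_lt_energy {u : ℕ → H2 L × H1 L} {p : H2 L × H1 L} (h : WeakConv u p)
    {r : ℝ} (hr : r < energy p) : ∀ᶠ n in atTop, r < energy (u n) := by
  rcases lt_or_ge r 0 with h0 | h0
  · exact Eventually.of_forall fun n => h0.trans_le (by rw [← energySeminorm_sq]; positivity)
  · have h1 : √r < energySeminorm L p := by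
      rwa [Real.sqrt_lt' (lt_of_le_of_ne (apply_nonneg _ _) ?_), energySeminorm_sq]
      intro h'
      rw [← energySeminorm_sq, ← h'] at hr
      linarith [zero_pow (M₀ := ℝ) two_ne_zero]
    filter_upwards [h.eventually_lt_seminorm continuous_energySeminorm h1] with n hn
    rw [← energySeminorm_sq]
    exact (Real.sqrt_lt h0 (apply_nonneg _ _)).1 hn

variable {m : ℝ → ℝ → ℝ} {c₀ c₁ c₂ cuni : ℝ}

theorem IsRegModulus.abs_integral_Qreg_sub_le (hm : IsRegModulus m c₀ c₁ c₂ cuni) (hL : 0 ≤ L)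
    {δ : ℝ} (hδ : 0 ≤ δ) (p : H2 L × H1 L) :
    |(∫ x in Ioo 0 L, Qreg m δ ‖D 2 p.1 x‖ ‖D 1 p.2 x‖) - energy p| ≤
      5 / 2 * cuni * L * δ := by
  have hmeas : Measurable fun z : ℝ × ℝ => Qreg m δ z.1 z.2 := by
    unfold Qreg
    have := hm.measurable hδ
    fun_prop
  have hae : AEStronglyMeasurable (fun x => Qreg m δ ‖D 2 p.1 x‖ ‖D 1 p.2 x‖) (vol L) :=
    (hmeas.comp_aemeasurable ((Lp.aestronglyMeasurable (D 2 p.1)).norm.aemeasurable.prodMk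
      (Lp.aestronglyMeasurable (D 1 p.2)).norm.aemeasurable)).aestronglyMeasurable
  have hq := integrable_Qbar (D 2 p.1) (D 1 p.2)
  have hd : Integrable (fun x => Qreg m δ ‖D 2 p.1 x‖ ‖D 1 p.2 x‖ - Qbar ‖D 2 p.1 x‖ ‖D 1 p.2 x‖)
      (vol L) :=
    Integrable.of_bound (hae.sub hq.aestronglyMeasurable) (5 / 2 * (cuni * δ))
      (Eventually.of_forall fun x => hm.abs_Qreg_sub_le hδ _ _)
  have hr : Integrable (fun x => Qreg m δ ‖D 2 p.1 x‖ ‖D 1 p.2 x‖) (vol L) :=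
    (hd.add hq).congr (Eventually.of_forall fun x => by simp)
  rw [energy, ← integral_sub hr hq, ← Real.norm_eq_abs]
  refine (norm_integral_le_of_norm_le_const (C := 5 / 2 * (cuni * δ))
    (Eventually.of_forall fun x => hm.abs_Qreg_sub_le hδ _ _)).trans_eq ?_
  simp [Measure.real, ENNReal.toReal_ofReal hL]
  ring

theorem IsRegModulus.energyReg_zero (hm : IsRegModulus m c₀ c₁ c₂ cuni) (ε : ℝ)
    (p : H2 L × H1 L) : energyReg m 0 ε p = energy p + 1 / (2 * ε) * shearSq p := by
  simp only [energyReg, hm.Qreg_zero, energy]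

theorem IsRegModulus.abs_energyReg_sub_le (hm : IsRegModulus m c₀ c₁ c₂ cuni) (hL : 0 ≤ L)
    {δ : ℝ} (hδ : 0 ≤ δ) (ε : ℝ) (p : H2 L × H1 L) :
    |energyReg m δ ε p - (energy p + 1 / (2 * ε) * shearSq p)| ≤ 5 / 2 * cuni * L * δ := by
  rw [energyReg, add_sub_add_right_eq_sub]
  exact hm.abs_integral_Qreg_sub_le hL hδ p

theorem shearSq_nonneg (p : H2 L × H1 L) : 0 ≤ shearSq p := integral_nonneg fun _ => sq_nonneg _

theorem Unshearable.shearSq_eq_zero {p : H2 L × H1 L} (h : Unshearable p) : shearSq p = 0 := by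
  refine integral_eq_zero_of_ae ?_
  filter_upwards [h] with x hx
  rw [hx]
  simp

end Energy

/-! ### Weak convergence of admissible frames -/

section WeakConvergence

/-- Convergence in `E3` is coordinatewise, and each coordinate of `T` is a functional. Applied to
point evaluations, this replaces compact embedding arguments. -/
theorem WeakConv.tendsto_clm {X : Type*} [NormedAddCommGroup X] [NormedSpace ℝ X] {u : ℕ → X}
    {x : X} (h : WeakConv u x) (T : X →L[ℝ] E3) :
    Tendsto (fun n => T (u n)) atTop (𝓝 (T x)) :=
  ((PiLp.continuous_toLp 2 (fun _ : Fin 3 => ℝ)).tendsto _).comp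
    (tendsto_pi_nhds.2 fun i => h ((EuclideanSpace.proj i).comp T))

theorem WeakConv.exists_norm_le {X : Type*} [NormedAddCommGroup X] [NormedSpace ℝ X] {u : ℕ → X}
    {x : X} (h : WeakConv u x) : ∃ C, ∀ n, ‖u n‖ ≤ C := by
  obtain ⟨C, hC⟩ := banach_steinhaus (g := fun n => NormedSpace.inclusionInDoubleDual ℝ X (u n))
    fun f => by
      obtain ⟨C, hC⟩ := (h f).norm.bddAbove_range
      exact ⟨C, fun n => hC ⟨n, rfl⟩⟩
  refine ⟨C, fun n => ?_⟩
  rw [← (NormedSpace.inclusionInDoubleDualLi (E := X) ℝ).norm_map]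
  exact hC n

theorem StrongConv.weakConv {X : Type*} [NormedAddCommGroup X] [NormedSpace ℝ X] {u : ℕ → X}
    {x : X} (h : StrongConv u x) : WeakConv u x := fun f => (f.continuous.tendsto x).comp h

theorem WeakConv.comp {X : Type*} [NormedAddCommGroup X] [NormedSpace ℝ X] {u : ℕ → X}
    {x : X} (h : WeakConv u x) {φ : ℕ → ℕ} (hφ : StrictMono φ) : WeakConv (u ∘ φ) x :=
  fun f => (h f).comp hφ.tendsto_atTop

variable {L : ℝ}

/-- The value of `y` at `x`. -/
def positionAt (L x : ℝ) : H2 L × H1 L →L[ℝ] E3 :=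
  (crepAt L x).comp (((Dclm L 0).prod (Dclm L 1)).comp (ContinuousLinearMap.fst ℝ _ _))

/-- The value of `y'` at `x`. -/
def tangentAt (L x : ℝ) : H2 L × H1 L →L[ℝ] E3 :=
  (crepAt L x).comp (((Dclm L 1).prod (Dclm L 2)).comp (ContinuousLinearMap.fst ℝ _ _))

/-- The value of `b` at `x`. -/
def directorAt (L x : ℝ) : H2 L × H1 L →L[ℝ] E3 :=
  (crepAt L x).comp (((Dclm L 0).prod (Dclm L 1)).comp (ContinuousLinearMap.snd ℝ _ _))

/-- The boundary values of a frame. -/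
def bdryVals (p : H2 L × H1 L) : BdryVals :=
  (positionAt L 0 p, positionAt L L p, tangentAt L 0 p, tangentAt L L p, directorAt L 0 p,
    directorAt L L p)

theorem isContRep_position (hL : 0 < L) (p : H2 L × H1 L) :
    IsContRep L (D 0 p.1) fun x => positionAt L x p :=
  ⟨(continuous_crep _ _).continuousOn, (isWeakDeriv_zero_H2 p.1).ae_eq_crep hL⟩

theorem isContRep_tangent (hL : 0 < L) (p : H2 L × H1 L) :
    IsContRep L (D 1 p.1) fun x => tangentAt L x p :=
  ⟨(continuous_crep _ _).continuousOn, (isWeakDeriv_one_H2 p.1).ae_eq_crep hL⟩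

theorem isContRep_director (hL : 0 < L) (p : H2 L × H1 L) :
    IsContRep L (D 0 p.2) fun x => directorAt L x p :=
  ⟨(continuous_crep _ _).continuousOn, (isWeakDeriv_H1 p.2).ae_eq_crep hL⟩

variable {W : Type*} [NormedAddCommGroup W] [NormedSpace ℝ W] {Lbc : BdryVals →L[ℝ] W} {lbc : W}

theorem satisfiesBC_iff (hL : 0 < L) (p : H2 L × H1 L) :
    SatisfiesBC Lbc lbc p.1 p.2 ↔ Lbc (bdryVals p) = lbc := by
  have h0 : (0 : ℝ) ∈ Icc 0 L := ⟨le_rfl, hL.le⟩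
  have h1 : L ∈ Icc 0 L := ⟨hL.le, le_rfl⟩
  constructor
  · rintro ⟨f, g, h, hf, hg, hh, hbc⟩
    rw [← hbc]
    have h2 := isContRep_position hL p
    have h3 := isContRep_tangent hL p
    have h4 := isContRep_director hL p
    refine congrArg Lbc ?_
    simp only [bdryVals, Prod.mk.injEq]
    exact ⟨h2.eqOn hL hf h0, h2.eqOn hL hf h1, h3.eqOn hL hg h0, h3.eqOn hL hg h1,
      h4.eqOn hL hh h0, h4.eqOn hL hh h1⟩
  · exact fun h => ⟨_, _, _, isContRep_position hL p, isContRep_tangent hL p,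
      isContRep_director hL p, h⟩

/-- By continuity of the representatives the almost everywhere constraint holds at every point of
`[0, L]`. In this form it involves only point evaluations, which pass to weak limits. -/
theorem mem_admissible_iff (hL : 0 < L) (p : H2 L × H1 L) :
    p ∈ admissible L Lbc lbc ↔ (∀ x ∈ Icc 0 L, ‖tangentAt L x p‖ = 1 ∧ ‖directorAt L x p‖ = 1 ∧
      inner ℝ (tangentAt L x p) (directorAt L x p) = 0) ∧ Lbc (bdryVals p) = lbc := by
  rw [admissible, mem_ofPred_eq, satisfiesBC_iff hL]
  refine and_congr_left fun _ => ?_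
  have ht := isContRep_tangent hL p
  have hd := isContRep_director hL p
  simp only [frameMatrix_mem_iff]
  constructor
  · intro h
    have h1 := eqOn_Icc_of_ae_eq hL (f := fun x => ‖tangentAt L x p‖) (g := fun _ => 1)
      (by filter_upwards [h, ht.2] with x h h'; rw [← h', h.1]) ht.1.norm continuousOn_const
    have h2 := eqOn_Icc_of_ae_eq hL (f := fun x => ‖directorAt L x p‖) (g := fun _ => 1)
      (by filter_upwards [h, hd.2] with x h h'; rw [← h', h.2.1]) hd.1.norm continuousOn_const
    have h3 := eqOn_Icc_of_ae_eq hL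
      (f := fun x => inner ℝ (tangentAt L x p) (directorAt L x p)) (g := fun _ => 0)
      (by filter_upwards [h, ht.2, hd.2] with x h h' h''; rw [← h', ← h'', h.2.2])
      (ht.1.inner hd.1) continuousOn_const
    exact fun x hx => ⟨h1 hx, h2 hx, h3 hx⟩
  · intro h
    filter_upwards [ht.2, hd.2, ae_restrict_mem measurableSet_Ioo] with x h1 h2 hx
    rw [h1, h2]
    exact h x (Ioo_subset_Icc_self hx)

theorem admissible.ae_norm_tangent {p : H2 L × H1 L}
    (hp : p ∈ admissible L Lbc lbc) : ∀ᵐ x ∂(vol L), ‖D 1 p.1 x‖ = 1 :=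
  hp.1.mono fun _ hx => ((frameMatrix_mem_iff _ _).1 hx).1

/-- The set of admissible frames is weakly closed. -/
theorem WeakConv.mem_admissible (hL : 0 < L) {u : ℕ → H2 L × H1 L} {p : H2 L × H1 L}
    (h : WeakConv u p) (hu : ∀ n, u n ∈ admissible L Lbc lbc) : p ∈ admissible L Lbc lbc := by
  simp only [mem_admissible_iff hL] at hu ⊢
  refine ⟨fun x hx => ⟨?_, ?_, ?_⟩, ?_⟩
  · exact tendsto_nhds_unique (h.tendsto_clm (tangentAt L x)).norm
      (by simp only [((hu _).1 x hx).1]; exact tendsto_const_nhds)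
  · exact tendsto_nhds_unique (h.tendsto_clm (directorAt L x)).norm
      (by simp only [((hu _).1 x hx).2.1]; exact tendsto_const_nhds)
  · exact tendsto_nhds_unique
      ((h.tendsto_clm (tangentAt L x)).inner (h.tendsto_clm (directorAt L x)))
      (by simp only [((hu _).1 x hx).2.2]; exact tendsto_const_nhds)
  · have h1 : Tendsto (fun n => bdryVals (u n)) atTop (𝓝 (bdryVals p)) :=
      (h.tendsto_clm (positionAt L 0)).prodMk_nhds ((h.tendsto_clm (positionAt L L)).prodMk_nhds
        ((h.tendsto_clm (tangentAt L 0)).prodMk_nhds ((h.tendsto_clm (tangentAt L L)).prodMk_nhds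
          ((h.tendsto_clm (directorAt L 0)).prodMk_nhds (h.tendsto_clm (directorAt L L))))))
    exact tendsto_nhds_unique ((Lbc.continuous.tendsto _).comp h1)
      (by simp only [Function.comp_def, (hu _).2]; exact tendsto_const_nhds)

/-- The tangents of a weakly convergent sequence of admissible frames converge boundedly. -/
theorem WeakConv.tendsto_integral_tangent (hL : 0 < L) {u : ℕ → H2 L × H1 L} {p : H2 L × H1 L}
    (h : WeakConv u p) (hu : ∀ n, u n ∈ admissible L Lbc lbc) {f : ℝ → ℝ}
    (hf : Integrable f (vol L)) :
    Tendsto (fun n => ∫ x in Ioo 0 L, ‖D 1 (u n).1 x - D 1 p.1 x‖ ^ 2 * f x) atTop (𝓝 0) := by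
  have hp := h.mem_admissible hL hu
  suffices h0 : Tendsto (fun n => ∫ x in Ioo 0 L, ‖D 1 (u n).1 x - D 1 p.1 x‖ ^ 2 * f x) atTop
      (𝓝 (∫ _ in Ioo 0 L, (0 : ℝ))) by rwa [integral_zero] at h0
  -- Two unit vectors are at distance at most `2`, whence the dominating factor `4`.
  refine tendsto_integral_of_dominated_convergence (fun x => 4 * ‖f x‖) (fun n => ?_)
    (hf.norm.const_mul 4) (fun n => ?_) ?_
  · exact (((Lp.aestronglyMeasurable _).sub (Lp.aestronglyMeasurable _)).norm.pow 2).mul hf.1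
  · filter_upwards [admissible.ae_norm_tangent hp, admissible.ae_norm_tangent (hu n)]
      with x h1 h2
    rw [norm_mul, norm_pow, norm_norm]
    have h3 := norm_sub_le (D 1 (u n).1 x) (D 1 p.1 x)
    rw [h1, h2] at h3
    exact mul_le_mul_of_nonneg_right (by nlinarith [norm_nonneg (D 1 (u n).1 x - D 1 p.1 x)])
      (norm_nonneg _)
  · filter_upwards [(isContRep_tangent hL p).2,
      ae_all_iff.2 fun n => (isContRep_tangent hL (u n)).2] with x h1 h2
    have h3 := ((h.tendsto_clm (tangentAt L x)).sub_const (tangentAt L x p)).norm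
    simp only [sub_self, norm_zero] at h3
    simpa [h1, h2] using (h3.pow 2).mul_const (f x)

end WeakConvergence

/-! ### The shear -/

section Shear

variable {L : ℝ} {W : Type*} [NormedAddCommGroup W] [NormedSpace ℝ W] {Lbc : BdryVals →L[ℝ] W}
  {lbc : W}

theorem memLp_shear {p : H2 L × H1 L} (hp : p ∈ admissible L Lbc lbc) :
    MemLp (fun x => inner ℝ (D 1 p.1 x) (D 1 p.2 x)) 2 (vol L) := by
  refine MemLp.of_le (Lp.memLp (D 1 p.2))
    ((Lp.aestronglyMeasurable _).inner (Lp.aestronglyMeasurable _)) ?_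
  filter_upwards [admissible.ae_norm_tangent hp] with x hx
  simpa [hx] using norm_inner_le_norm (𝕜 := ℝ) (D 1 p.1 x) (D 1 p.2 x)

theorem admissible.unshearable {p : H2 L × H1 L} (hp : p ∈ admissible L Lbc lbc)
    (h : shearSq p ≤ 0) : Unshearable p := by
  have h1 := (integral_eq_zero_iff_of_nonneg (fun _ => sq_nonneg _)
    (memLp_shear hp).integrable_sq).1 (le_antisymm h (shearSq_nonneg p))
  filter_upwards [h1] with x hx
  exact pow_eq_zero_iff two_ne_zero |>.1 hx

/-- Let `ψ` be the shear of the limit and `s_n` that of `u n`. Then `∫ s_n² ≥ 2 ∫ ψ s_n - ∫ ψ²`, and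
`∫ ψ s_n` is the `L²` product of `ψ y_n'` with `b_n'`. The first factor converges strongly by
dominated convergence and the second weakly, so the product tends to `∫ ψ²`. -/
theorem WeakConv.eventually_lt_shearSq (hL : 0 < L) {u : ℕ → H2 L × H1 L} {p : H2 L × H1 L}
    (h : WeakConv u p) (hu : ∀ n, u n ∈ admissible L Lbc lbc) {r : ℝ} (hr : r < shearSq p) :
    ∀ᶠ n in atTop, r < shearSq (u n) := by
  have hp := h.mem_admissible hL hu
  set ψ : ℝ → ℝ := fun x => inner ℝ (D 1 p.1 x) (D 1 p.2 x) with hψ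
  have hψ2 : MemLp ψ 2 (vol L) := memLp_shear hp
  have hg : ∀ q ∈ admissible L Lbc lbc, MemLp (fun x => ψ x • D 1 q.1 x) 2 (vol L) := by
    intro q hq
    refine MemLp.of_le hψ2 (hψ2.1.smul (Lp.aestronglyMeasurable _)) ?_
    filter_upwards [admissible.ae_norm_tangent hq] with x hx
    rw [norm_smul, hx, mul_one]
  let g : ℕ → L2 L := fun n => (hg _ (hu n)).toLp
  let g₀ : L2 L := (hg _ hp).toLp
  have hgt : Tendsto (fun n => ‖g n - g₀‖) atTop (𝓝 0) := by
    have h1 := h.tendsto_integral_tangent hL hu hψ2.integrable_sq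
    have h2 : ∀ n, ∫ x in Ioo 0 L, ‖D 1 (u n).1 x - D 1 p.1 x‖ ^ 2 * ψ x ^ 2
        = ‖g n - g₀‖ ^ 2 := by
      intro n
      rw [norm_sq_eq_integral]
      refine integral_congr_ae ?_
      filter_upwards [Lp.coeFn_sub (g n) g₀, (hg _ (hu n)).coeFn_toLp, (hg _ hp).coeFn_toLp]
        with x h1 h2 h3
      rw [h1, Pi.sub_apply, h2, h3, ← smul_sub, norm_smul, mul_pow, Real.norm_eq_abs, sq_abs,
        mul_comm]
    simp only [h2] at h1
    simpa using h1.sqrt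
  obtain ⟨C, hC⟩ := h.exists_norm_le
  have hpair : ∀ q (hq : q ∈ admissible L Lbc lbc), inner ℝ (hg q hq).toLp (D 1 q.2)
      = ∫ x in Ioo 0 L, ψ x * inner ℝ (D 1 q.1 x) (D 1 q.2 x) := by
    intro q hq
    rw [L2.inner_def]
    refine integral_congr_ae ?_
    filter_upwards [(hg q hq).coeFn_toLp] with x hx
    rw [hx, real_inner_smul_left]
  have h0 : inner ℝ g₀ (D 1 p.2) = shearSq p := by
    rw [hpair p hp, shearSq]
    simp only [hψ, sq]
  have hlim : Tendsto (fun n => inner ℝ (g n) (D 1 (u n).2)) atTop (𝓝 (shearSq p)) := by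
    have h1 : Tendsto (fun n => inner ℝ g₀ (D 1 (u n).2)) atTop (𝓝 (inner ℝ g₀ (D 1 p.2))) :=
      h ((innerSL ℝ g₀).comp ((Dclm L 1).comp (ContinuousLinearMap.snd ℝ _ _)))
    have h2 : Tendsto (fun n => inner ℝ (g n - g₀) (D 1 (u n).2)) atTop (𝓝 0) := by
      refine squeeze_zero_norm (a := fun n => ‖g n - g₀‖ * C) (fun n => ?_)
        (by simpa using hgt.mul_const C)
      refine (norm_inner_le_norm _ _).trans (mul_le_mul_of_nonneg_left ?_ (norm_nonneg _))
      exact ((norm_D_le 1 _).trans (norm_snd_le (u n))).trans (hC n)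
    have h3 := h2.add h1
    rw [h0, zero_add] at h3
    refine h3.congr fun n => ?_
    rw [inner_sub_left, sub_add_cancel]
  have hlow : ∀ n, 2 * inner ℝ (g n) (D 1 (u n).2) - shearSq p ≤ shearSq (u n) := by
    intro n
    have hn := memLp_shear (hu n)
    have h1 : 0 ≤ ∫ x in Ioo 0 L, (inner ℝ (D 1 (u n).1 x) (D 1 (u n).2 x) - ψ x) ^ 2 :=
      integral_nonneg fun _ => sq_nonneg _
    have h2 : ∀ x, (inner ℝ (D 1 (u n).1 x) (D 1 (u n).2 x) - ψ x) ^ 2 =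
        (inner ℝ (D 1 (u n).1 x) (D 1 (u n).2 x) ^ 2 -
          2 * (ψ x * inner ℝ (D 1 (u n).1 x) (D 1 (u n).2 x))) + ψ x ^ 2 := fun x => by ring
    have h3 : Integrable (fun x => ψ x * inner ℝ (D 1 (u n).1 x) (D 1 (u n).2 x)) (vol L) :=
      hψ2.integrable_mul hn
    have h7 : Integrable (fun x => inner ℝ (D 1 (u n).1 x) (D 1 (u n).2 x) ^ 2 -
        2 * (ψ x * inner ℝ (D 1 (u n).1 x) (D 1 (u n).2 x))) (vol L) :=
      hn.integrable_sq.sub (h3.const_mul 2)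
    simp only [h2] at h1
    rw [integral_add h7 hψ2.integrable_sq,
      integral_sub hn.integrable_sq (h3.const_mul 2), integral_const_mul, ← hpair _ (hu n)] at h1
    have h4 : shearSq p = ∫ x in Ioo 0 L, ψ x ^ 2 := rfl
    have h5 : shearSq (u n) = ∫ x in Ioo 0 L, inner ℝ (D 1 (u n).1 x) (D 1 (u n).2 x) ^ 2 := rfl
    have h6 : inner ℝ (g n) (D 1 (u n).2) = inner ℝ (hg _ (hu n)).toLp (D 1 (u n).2) := rfl
    linarith
  have hlim2 := (hlim.const_mul 2).sub_const (shearSq p)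
  filter_upwards [hlim2.eventually (lt_mem_nhds (by linarith : r < 2 * shearSq p - shearSq p))]
    with n hn
  exact hn.trans_le (hlow n)

/-- The shear tends to zero along strongly convergent sequences with an unshearable limit. -/
theorem StrongConv.tendsto_shearSq (hL : 0 < L) {u : ℕ → H2 L × H1 L} {p : H2 L × H1 L}
    (h : StrongConv u p) (hu : ∀ n, u n ∈ admissible L Lbc lbc) (hp : Unshearable p) :
    Tendsto (fun n => shearSq (u n)) atTop (𝓝 0) := by
  have h1 := h.weakConv.tendsto_integral_tangent hL hu (integrable_norm_sq (D 1 p.2))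
  have h2 : Tendsto (fun n => ‖D 1 (u n).2 - D 1 p.2‖ ^ 2) atTop (𝓝 0) := by
    have h3 := ((((Dclm L 1).comp (ContinuousLinearMap.snd ℝ (H2 L) (H1 L))).continuous.tendsto
      p).comp h).sub_const (D 1 p.2)
    have h4 : ((Dclm L 1).comp (ContinuousLinearMap.snd ℝ (H2 L) (H1 L))) p - D 1 p.2 = 0 :=
      sub_self _
    rw [h4] at h3
    simpa using h3.norm.pow 2
  have h3 := (h2.const_mul 2).add (h1.const_mul 2)
  rw [mul_zero, add_zero] at h3
  refine squeeze_zero (fun n => shearSq_nonneg _) (fun n => ?_) h3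
  have hi1 := integrable_norm_sq (D 1 (u n).2 - D 1 p.2)
  have hi2 : Integrable (fun x => ‖D 1 (u n).1 x - D 1 p.1 x‖ ^ 2 * ‖D 1 p.2 x‖ ^ 2) (vol L) := by
    refine Integrable.mono' ((integrable_norm_sq (D 1 p.2)).const_mul 4)
      ((((Lp.aestronglyMeasurable _).sub (Lp.aestronglyMeasurable _)).norm.pow 2).mul
        ((Lp.aestronglyMeasurable _).norm.pow 2)) ?_
    filter_upwards [admissible.ae_norm_tangent (h.weakConv.mem_admissible hL hu),
      admissible.ae_norm_tangent (hu n)] with x h1 h2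
    rw [norm_mul, norm_pow, norm_pow, norm_norm, norm_norm]
    have h3 := norm_sub_le (D 1 (u n).1 x) (D 1 p.1 x)
    rw [h1, h2] at h3
    exact mul_le_mul_of_nonneg_right (by nlinarith [norm_nonneg (D 1 (u n).1 x - D 1 p.1 x)])
      (sq_nonneg _)
  rw [norm_sq_eq_integral, ← integral_const_mul, ← integral_const_mul,
    ← integral_add (hi1.const_mul 2) (hi2.const_mul 2)]
  refine integral_mono_ae (memLp_shear (hu n)).integrable_sq
    ((hi1.const_mul 2).add (hi2.const_mul 2)) ?_
  filter_upwards [hp, Lp.coeFn_sub (D 1 (u n).2) (D 1 p.2), admissible.ae_norm_tangent (hu n)]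
    with x hx h2 h3
  rw [h2, Pi.sub_apply]
  set t := D 1 (u n).1 x
  set t₀ := D 1 p.1 x
  set b := D 1 (u n).2 x
  set b₀ := D 1 p.2 x
  -- Since `t₀ · b₀ = 0`, the shear splits into a term controlled by the convergence of `b'` and one
  -- controlled by the bounded convergence of the tangents with weight `|b₀|²`.
  have h4 : inner ℝ t b = inner ℝ t (b - b₀) + inner ℝ (t - t₀) b₀ := by
    rw [inner_sub_right, inner_sub_left, hx]
    ring
  have h5 := abs_le.1 (abs_real_inner_le_norm t (b - b₀))
  have h6 := abs_le.1 (abs_real_inner_le_norm (t - t₀) b₀)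
  rw [h3, one_mul] at h5
  have h7 : (inner ℝ t (b - b₀)) ^ 2 ≤ ‖b - b₀‖ ^ 2 := sq_le_sq' h5.1 h5.2
  have h8 : (inner ℝ (t - t₀) b₀) ^ 2 ≤ (‖t - t₀‖ * ‖b₀‖) ^ 2 := sq_le_sq' h6.1 h6.2
  rw [mul_pow] at h8
  change (inner ℝ t b) ^ 2 ≤ 2 * ‖b - b₀‖ ^ 2 + 2 * (‖t - t₀‖ ^ 2 * ‖b₀‖ ^ 2)
  rw [h4]
  nlinarith [sq_nonneg (inner ℝ t (b - b₀) - inner ℝ (t - t₀) b₀)]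

end Shear

/-! ### Gamma convergence -/

section Gamma

/-- The lower bound is needed only for weak convergence, and constant recovery sequences converge in
both senses. If the lower bound failed, a real `r` would lie strictly between the liminf and the
limit value; the `u` of `hlow` is the subsequence with values below `r`, which is finite and hence
lies in `A`. -/
theorem gammaConv_of_weak {X : Type*} [NormedAddCommGroup X] [NormedSpace ℝ X] {A A₀ : Set X}
    {F : ℕ → X → ℝ} {F₀ : X → ℝ}
    (hlow : ∀ (x : X) (u : ℕ → X) (φ : ℕ → ℕ) (r : ℝ), WeakConv u x → StrictMono φ →
      (∀ n, u n ∈ A) → (∀ n, F (φ n) (u n) < r) → x ∈ A₀ ∧ F₀ x ≤ r)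
    (hrec : ∀ x ∈ A₀, x ∈ A ∧ Tendsto (fun n => F n x) atTop (𝓝 (F₀ x))) :
    GammaConv WeakConv (fun n => constrained A (F n)) (constrained A₀ F₀) ∧
      GammaConv StrongConv (fun n => constrained A (F n)) (constrained A₀ F₀) := by
  have hl : ∀ (x : X) (u : ℕ → X), WeakConv u x →
      constrained A₀ F₀ x ≤ liminf (fun n => constrained A (F n) (u n)) atTop := by
    intro x u hu
    by_contra! hc
    obtain ⟨r, hr1, hr2⟩ := EReal.lt_iff_exists_real_btwn.1 hc
    obtain ⟨φ, hφ, hφr⟩ := extraction_of_frequently_atTop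
      (frequently_lt_of_liminf_lt (by isBoundedDefault) hr1)
    have hA : ∀ n, u (φ n) ∈ A := fun n => by
      by_contra h
      have := hφr n
      rw [constrained, if_neg h] at this
      exact not_top_lt this
    obtain ⟨h1, h2⟩ := hlow x (u ∘ φ) φ r (hu.comp hφ) hφ hA fun n => by
      have := hφr n
      rw [constrained, if_pos (hA n)] at this
      exact EReal.coe_lt_coe_iff.1 this
    rw [constrained, if_pos h1] at hr2
    exact absurd (EReal.coe_lt_coe_iff.1 hr2) (not_lt.2 h2)
  have hr : ∀ x : X, limsup (fun n => constrained A (F n) x) atTop ≤ constrained A₀ F₀ x := by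
    intro x
    by_cases hx : x ∈ A₀
    · obtain ⟨h1, h2⟩ := hrec x hx
      simp only [constrained, if_pos hx, if_pos h1]
      exact ((continuous_coe_real_ereal.tendsto _).comp h2).limsup_eq.le
    · simp only [constrained, if_neg hx]
      exact le_top
  have hs : ∀ x : X, StrongConv (fun _ : ℕ => x) x := fun x => tendsto_const_nhds
  exact ⟨⟨hl, fun x => ⟨fun _ => x, (hs x).weakConv, hr x⟩⟩,
    ⟨fun x u hu => hl x u hu.weakConv, fun x => ⟨fun _ => x, hs x, hr x⟩⟩⟩

variable {L : ℝ} {W : Type*} [NormedAddCommGroup W] [NormedSpace ℝ W] {Lbc : BdryVals →L[ℝ] W}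
  {lbc : W} {m : ℝ → ℝ → ℝ} {c₀ c₁ c₂ cuni : ℝ}

theorem WeakConv.energy_le {u : ℕ → H2 L × H1 L} {p : H2 L × H1 L} (h : WeakConv u p) {r : ℝ}
    {e : ℕ → ℝ} (he : Tendsto e atTop (𝓝 0)) (hr : ∀ n, energy (u n) ≤ r + e n) :
    energy p ≤ r := by
  by_contra! hc
  have h1 : r < (r + energy p) / 2 := by linarith
  have h2 : (r + energy p) / 2 < energy p := by linarith
  have h3 : Tendsto (fun n => r + e n) atTop (𝓝 (r + 0)) := he.const_add r
  rw [add_zero] at h3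
  obtain ⟨n, hn1, hn2⟩ := ((h.eventually_lt_energy h2).and (h3.eventually (gt_mem_nhds h1))).exists
  linarith [hr n]

/-- A bound `r` on the values forces the shear to be at most `2ε (r + O(δ))`, so the limit is
unshearable. Dropping the nonnegative penalty then leaves the lower semicontinuity of `energy`. -/
theorem isGammaLimit_vanishing_penalty (hL : 0 < L) (hm : IsRegModulus m c₀ c₁ c₂ cuni)
    {δ ε : ℕ → ℝ} (hδ : ∀ n, 0 ≤ δ n) (hε : ∀ n, 0 < ε n) (hδ0 : Tendsto δ atTop (𝓝 0))
    (hε0 : Tendsto ε atTop (𝓝 0)) :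
    IsGammaLimit (fun n => constrained (admissible L Lbc lbc) (energyReg m (δ n) (ε n)))
      (constrained {p | p ∈ admissible L Lbc lbc ∧ Unshearable p} energy) := by
  have hK : Tendsto (fun n => 5 / 2 * cuni * L * δ n) atTop (𝓝 0) := by
    simpa using hδ0.const_mul (5 / 2 * cuni * L)
  refine gammaConv_of_weak (fun p u φ r hu hφ hA hF => ?_) fun p hp => ⟨hp.1, ?_⟩
  · have hb := fun n => abs_le.1 (hm.abs_energyReg_sub_le hL.le (hδ (φ n)) (ε (φ n)) (u n))
    have hs : ∀ n, 0 ≤ 1 / (2 * ε (φ n)) * shearSq (u n) := fun n =>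
      mul_nonneg (by have := hε (φ n); positivity) (shearSq_nonneg _)
    have he : ∀ n, 0 ≤ energy (u n) := fun n => by rw [← energySeminorm_sq]; positivity
    have hp := hu.mem_admissible hL hA
    have hKφ := hK.comp hφ.tendsto_atTop
    refine ⟨⟨hp, admissible.unshearable hp ?_⟩, hu.energy_le hKφ fun n => ?_⟩
    · by_contra! hc
      have h1 : Tendsto (fun n => 2 * ε (φ n) * (r + 5 / 2 * cuni * L * δ (φ n))) atTop (𝓝 0) := by
        have := ((hε0.comp hφ.tendsto_atTop).const_mul 2).mul (hKφ.const_add r)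
        simpa using this
      obtain ⟨n, hn1, hn2⟩ := ((hu.eventually_lt_shearSq hL hA (half_lt_self hc)).and
        (h1.eventually (gt_mem_nhds (half_pos hc)))).exists
      have h2 : 1 / (2 * ε (φ n)) * shearSq (u n) ≤ r + 5 / 2 * cuni * L * δ (φ n) := by
        linarith [(hb n).1, hF n, he n]
      rw [one_div_mul_eq_div, div_le_iff₀ (by linarith [hε (φ n)])] at h2
      linarith
    · have := (hb n).1
      have := hF n
      have := hs n
      simp only [Function.comp_def]
      linarith
  · rw [tendsto_iff_norm_sub_tendsto_zero]
    refine squeeze_zero (fun _ => norm_nonneg _) (fun n => ?_) hK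
    have := hm.abs_energyReg_sub_le hL.le (hδ n) (ε n) p
    rwa [hp.2.shearSq_eq_zero, mul_zero, add_zero] at this

theorem isGammaLimit_fixed_penalty (hL : 0 < L) (hm : IsRegModulus m c₀ c₁ c₂ cuni)
    {ε : ℝ} (hε : 0 < ε) {δ : ℕ → ℝ} (hδ : ∀ n, 0 ≤ δ n) (hδ0 : Tendsto δ atTop (𝓝 0)) :
    IsGammaLimit (fun n => constrained (admissible L Lbc lbc) (energyReg m (δ n) ε))
      (constrained (admissible L Lbc lbc) (energyReg m 0 ε)) := by
  have hK : Tendsto (fun n => 5 / 2 * cuni * L * δ n) atTop (𝓝 0) := by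
    simpa using hδ0.const_mul (5 / 2 * cuni * L)
  refine gammaConv_of_weak (fun p u φ r hu hφ hA hF => ⟨hu.mem_admissible hL hA, ?_⟩)
    fun p hp => ⟨hp, ?_⟩
  · rw [hm.energyReg_zero]
    have hε' : 0 < 1 / (2 * ε) := by positivity
    by_contra! hc
    -- A quarter of the gap: the energy, the penalty and the regularization each lose less than `η`,
    -- and three such losses cannot exhaust `4η`.
    set η := (energy p + 1 / (2 * ε) * shearSq p - r) / 4 with hη
    have hη0 : 0 < η := by linarith
    have h1 : shearSq p - 2 * ε * η < shearSq p := by nlinarith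
    obtain ⟨n, ⟨hn1, hn2⟩, hn3⟩ := (((hu.eventually_lt_energy (sub_lt_self _ hη0)).and
      (hu.eventually_lt_shearSq hL hA h1)).and
      ((hK.comp hφ.tendsto_atTop).eventually (gt_mem_nhds hη0))).exists
    have h2 := (abs_le.1 (hm.abs_energyReg_sub_le hL.le (hδ (φ n)) ε (u n))).1
    have h3 := mul_lt_mul_of_pos_left hn2 hε'
    have h4 : 1 / (2 * ε) * (shearSq p - 2 * ε * η) = 1 / (2 * ε) * shearSq p - η := by
      field_simp
    simp only [Function.comp_def] at hn3
    have h5 := hF n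
    linarith
  · rw [tendsto_iff_norm_sub_tendsto_zero]
    refine squeeze_zero (fun _ => norm_nonneg _) (fun n => ?_) hK
    rw [hm.energyReg_zero]
    exact hm.abs_energyReg_sub_le hL.le (hδ n) ε p

end Gamma

/-! ### Normalization of vectors and frames -/

section Normalization

/-- The normalized vector `z / |z|`. -/
def unitize (z : E3) : E3 := ‖z‖⁻¹ • z

theorem norm_unitize {z : E3} (hz : z ≠ 0) : ‖unitize z‖ = 1 := by
  rw [unitize, norm_smul, norm_inv, norm_norm, inv_mul_cancel₀ (norm_ne_zero_iff.2 hz)]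

theorem unitize_of_norm_eq_one {z : E3} (hz : ‖z‖ = 1) : unitize z = z := by
  rw [unitize, hz, inv_one, one_smul]

theorem ne_zero_of_norm_eq_one {z : E3} (hz : ‖z‖ = 1) : z ≠ 0 := by
  rintro rfl
  simp at hz

theorem contDiffAt_unitize {n : WithTop ℕ∞} {z : E3} (hz : z ≠ 0) : ContDiffAt ℝ n unitize z :=
  ((contDiffAt_norm ℝ hz).inv (norm_ne_zero_iff.2 hz)).smul contDiffAt_id

theorem norm_unitize_sub_le {z t : E3} (hz : z ≠ 0) (ht : ‖t‖ = 1) :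
    ‖unitize z - t‖ ≤ 2 * ‖z - t‖ := by
  have h1 : ‖unitize z - z‖ = |1 - ‖z‖| := by
    have h2 : unitize z - z = (1 - ‖z‖) • unitize z := by
      rw [sub_smul, one_smul, unitize, smul_smul, mul_inv_cancel₀ (norm_ne_zero_iff.2 hz), one_smul]
    rw [h2, norm_smul, norm_unitize hz, mul_one, Real.norm_eq_abs]
  have h3 : |1 - ‖z‖| ≤ ‖z - t‖ := by
    rw [← ht, norm_sub_rev z t]
    exact abs_norm_sub_norm_le t z
  have h4 := norm_sub_le_norm_sub_add_norm_sub (unitize z) z t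
  linarith

/-- At a unit vector `z` the derivative of normalization is the orthogonal projection onto the
complement of `z`, found here by differentiating along `z + s v`. Its quadratic form is nonnegative
and vanishes only on multiples of `z`, which decides the injectivity of `meanDeriv`. -/
theorem inner_fderiv_unitize {z : E3} (hz : ‖z‖ = 1) (v : E3) :
    inner ℝ v (fderiv ℝ unitize z v) = ‖v‖ ^ 2 - inner ℝ z v ^ 2 := by
  have hz0 := ne_zero_of_norm_eq_one hz
  have hc : HasDerivAt (fun s : ℝ => z + s • v) v 0 := by
    simpa using ((hasDerivAt_id (0 : ℝ)).smul_const v).const_add z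
  have h1 : HasDerivAt (fun s : ℝ => unitize (z + s • v)) (fderiv ℝ unitize z v) 0 := by
    have h2 : HasFDerivAt unitize (fderiv ℝ unitize z) (z + (0 : ℝ) • v) := by
      rw [zero_smul, add_zero]
      exact ((contDiffAt_unitize (n := 1) hz0).differentiableAt (by simp)).hasFDerivAt
    exact h2.comp_hasDerivAt 0 hc
  have h3 := hc.norm_sq.sqrt (by simp [hz])
  have h4 := (h3.inv (by simp [hz])).smul hc
  have h5 : (fun s : ℝ => unitize (z + s • v)) =
      (fun s : ℝ => √(‖z + s • v‖ ^ 2))⁻¹ • fun s : ℝ => z + s • v := by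
    funext s
    simp [unitize, Real.sqrt_sq (norm_nonneg _)]
  rw [h5] at h1
  rw [h1.unique h4]
  simp only [zero_smul, add_zero, hz, inner_add_right, inner_smul_right, Pi.inv_apply]
  simp [real_inner_comm z v]
  ring

/-- The normal part of `w` with respect to the direction of `z`, normalized. -/
def unitNormal (z : E3 × E3) : E3 :=
  unitize (z.2 - inner ℝ z.2 (unitize z.1) • unitize z.1)

/-- The pairs of vectors to which the Gram-Schmidt process applies. -/
def nondegenerate : Set (E3 × E3) :=
  {z | z.1 ≠ 0 ∧ z.2 - inner ℝ z.2 (unitize z.1) • unitize z.1 ≠ 0}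

theorem contDiffAt_tangentMap {n : WithTop ℕ∞} {z : E3 × E3} (hz : z ∈ nondegenerate) :
    ContDiffAt ℝ n (fun z : E3 × E3 => unitize z.1) z :=
  (contDiffAt_unitize hz.1).comp z contDiffAt_fst

theorem contDiffAt_unitNormal {n : WithTop ℕ∞} {z : E3 × E3} (hz : z ∈ nondegenerate) :
    ContDiffAt ℝ n unitNormal z :=
  (contDiffAt_unitize hz.2).comp z (contDiffAt_snd.sub
    ((contDiffAt_snd.inner ℝ (contDiffAt_tangentMap hz)).smul (contDiffAt_tangentMap hz)))

theorem isOpen_nondegenerate : IsOpen nondegenerate := by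
  rw [isOpen_iff_mem_nhds]
  intro z hz
  have h1 : ContinuousAt (fun z : E3 × E3 => z.2 - inner ℝ z.2 (unitize z.1) • unitize z.1) z :=
    (contDiffAt_snd.sub ((contDiffAt_snd.inner ℝ (contDiffAt_tangentMap (n := 1) hz)).smul
      (contDiffAt_tangentMap (n := 1) hz))).continuousAt
  exact (continuousAt_fst.eventually_ne hz.1).and (h1.eventually_ne hz.2)

theorem norm_unitNormal {z : E3 × E3} (hz : z ∈ nondegenerate) : ‖unitNormal z‖ = 1 :=
  norm_unitize hz.2

theorem inner_unitize_unitNormal {z : E3 × E3} (hz : z ∈ nondegenerate) :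
    inner ℝ (unitize z.1) (unitNormal z) = 0 := by
  rw [unitNormal, unitize.eq_def (z.2 - _), inner_smul_right, inner_sub_right, inner_smul_right,
    real_inner_self_eq_norm_sq, norm_unitize hz.1, real_inner_comm]
  ring

theorem mem_nondegenerate {z : E3 × E3} (h1 : ‖z.1‖ = 1) (h2 : ‖z.2‖ = 1)
    (h3 : inner ℝ z.1 z.2 = 0) : z ∈ nondegenerate := by
  refine ⟨ne_zero_of_norm_eq_one h1, ?_⟩
  rw [unitize_of_norm_eq_one h1, real_inner_comm, h3, zero_smul, sub_zero]
  exact ne_zero_of_norm_eq_one h2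

theorem unitNormal_of_orthonormal {z : E3 × E3} (h1 : ‖z.1‖ = 1) (h2 : ‖z.2‖ = 1)
    (h3 : inner ℝ z.1 z.2 = 0) : unitNormal z = z.2 := by
  rw [unitNormal, unitize_of_norm_eq_one h1, real_inner_comm, h3, zero_smul, sub_zero,
    unitize_of_norm_eq_one h2]

/-- The derivative of a continuously differentiable map is uniformly continuous at a compact
set. -/
theorem exists_forall_norm_fderiv_sub_le {E F : Type*} [NormedAddCommGroup E] [NormedSpace ℝ E]
    [NormedAddCommGroup F] [NormedSpace ℝ F] {Φ : E → F} {K U : Set E} (hK : IsCompact K)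
    (hU : IsOpen U) (hKU : K ⊆ U) (hΦ : ∀ z ∈ U, ContDiffAt ℝ 2 Φ z) {c : ℝ} (hc : 0 < c) :
    ∃ r > 0, ∀ z ∈ K, ∀ z', dist z' z < r → z' ∈ U ∧ ‖fderiv ℝ Φ z' - fderiv ℝ Φ z‖ ≤ c := by
  obtain ⟨r₁, hr₁, hsub⟩ := hK.exists_thickening_subset_open hU hKU
  have h1 := hK.uniformContinuousAt_of_continuousAt (fderiv ℝ Φ)
    (fun z hz => ((hΦ z (hKU hz)).fderiv_right (m := 1) (by norm_num)).continuousAt)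
    (Metric.dist_mem_uniformity hc)
  obtain ⟨r₂, hr₂, h2⟩ := Metric.mem_uniformity_dist.1 h1
  refine ⟨min r₁ r₂, lt_min hr₁ hr₂, fun z hz z' hz' => ⟨hsub ?_, ?_⟩⟩
  · exact Metric.mem_thickening_iff.2 ⟨z, hz, hz'.trans_le (min_le_left _ _)⟩
  · have h3 := h2 (a := z) (b := z') (by rw [dist_comm]; exact hz'.trans_le (min_le_right _ _)) hz
    rw [← dist_eq_norm, dist_comm]
    exact le_of_lt h3

end Normalization

/-! ### Correction of the mean value -/

section Correction

variable {L : ℝ}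

/-- A weight with values in `[0, 1]` that vanishes at `0` and `L` only. -/
def bump (L x : ℝ) : ℝ := x * (L - x) / L ^ 2

theorem contDiff_bump {n : WithTop ℕ∞} : ContDiff ℝ n (bump L) := by
  unfold bump
  fun_prop

theorem bump_nonneg {x : ℝ} (hx : x ∈ Icc 0 L) : 0 ≤ bump L x :=
  div_nonneg (mul_nonneg hx.1 (sub_nonneg.2 hx.2)) (sq_nonneg _)

theorem bump_pos {x : ℝ} (hx : x ∈ Ioo 0 L) : 0 < bump L x :=
  div_pos (mul_pos hx.1 (sub_pos.2 hx.2)) (pow_pos (hx.1.trans hx.2) 2)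

theorem bump_le_one (hL : 0 < L) {x : ℝ} (hx : x ∈ Icc 0 L) : bump L x ≤ 1 := by
  rw [bump, div_le_one (by positivity)]
  nlinarith [hx.1, hx.2, mul_nonneg hx.1 (sub_nonneg.2 hx.2)]

theorem integrable_of_continuousOn {E : Type*} [NormedAddCommGroup E] {f : ℝ → E}
    (hf : ContinuousOn f (Icc 0 L)) : Integrable f (vol L) :=
  memLp_one_iff_integrable.1 (memLp_of_continuous hf 1)

theorem eqOn_zero_of_integral_eq_zero (hL : 0 < L) {f : ℝ → ℝ} (hf : ContinuousOn f (Icc 0 L))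
    (h0 : ∀ x ∈ Icc 0 L, 0 ≤ f x) (h : ∫ x in Ioo 0 L, f x = 0) : EqOn f 0 (Icc 0 L) := by
  have h1 := (integral_eq_zero_iff_of_nonneg_ae (μ := vol L)
    (by filter_upwards [ae_restrict_mem measurableSet_Ioo] with x hx
          using h0 x (Ioo_subset_Icc_self hx)) (integrable_of_continuousOn hf)).1 h
  exact eqOn_Icc_of_ae_eq hL h1 hf continuousOn_const

/-- The derivative of the mean value of the normalized curve `t + bump • s` at `s = 0`. -/
def meanDeriv (L : ℝ) (t : ℝ → E3) : E3 →L[ℝ] E3 :=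
  ∫ x in Ioo 0 L, bump L x • fderiv ℝ unitize (t x)

variable {t : ℝ → E3}

theorem continuousOn_fderiv_unitize (ht : ContinuousOn t (Icc 0 L))
    (h1 : ∀ x ∈ Icc 0 L, ‖t x‖ = 1) :
    ContinuousOn (fun x => bump L x • fderiv ℝ unitize (t x)) (Icc 0 L) :=
  (contDiff_bump (n := 0)).continuous.continuousOn.smul fun x hx =>
    (((contDiffAt_unitize (n := 2) (ne_zero_of_norm_eq_one (h1 x hx))).fderiv_right (m := 1)
      (by norm_num)).continuousAt).comp_continuousWithinAt (ht x hx)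

/-- If the derivative of the mean value is degenerate, then the curve is constant. -/
theorem eqOn_const_of_meanDeriv_not_injective (hL : 0 < L) (ht : ContinuousOn t (Icc 0 L))
    (h1 : ∀ x ∈ Icc 0 L, ‖t x‖ = 1) (h : ¬ Function.Injective (meanDeriv L t)) :
    ∀ x ∈ Icc 0 L, t x = t 0 := by
  rw [injective_iff_map_eq_zero] at h
  push Not at h
  obtain ⟨v, hv, hv0⟩ := h
  have hcont := continuousOn_fderiv_unitize ht h1
  -- Pairing a kernel vector `v` with its own image gives the integral of a nonnegative continuous
  -- function, which must then vanish identically.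
  have h2 : ∫ x in Ioo 0 L, bump L x * (‖v‖ ^ 2 - inner ℝ (t x) v ^ 2) = 0 := by
    have h3 : inner ℝ v (meanDeriv L t v) = 0 := by rw [hv, inner_zero_right]
    rw [meanDeriv, ContinuousLinearMap.integral_apply (integrable_of_continuousOn hcont),
      ← integral_inner (integrable_of_continuousOn (hcont.clm_apply continuousOn_const))] at h3
    refine Eq.trans ?_ h3
    refine setIntegral_congr_fun measurableSet_Ioo fun x hx => ?_
    simp only [smul_apply, inner_smul_right]
    rw [inner_fderiv_unitize (h1 x (Ioo_subset_Icc_self hx))]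
  have hin : ContinuousOn (fun x => inner ℝ (t x) v) (Icc 0 L) := ht.inner continuousOn_const
  have hle : ∀ x ∈ Icc 0 L, inner ℝ (t x) v ^ 2 ≤ ‖v‖ ^ 2 := fun x hx => by
    have := abs_real_inner_le_norm (t x) v
    rw [h1 x hx, one_mul] at this
    exact sq_le_sq' (abs_le.1 this).1 (abs_le.1 this).2
  have h3 := eqOn_zero_of_integral_eq_zero hL
    ((contDiff_bump (n := 0)).continuous.continuousOn.mul (continuousOn_const.sub (hin.pow 2)))
    (fun x hx => mul_nonneg (bump_nonneg hx) (sub_nonneg.2 (hle x hx))) h2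
  have h4 : EqOn (fun x => inner ℝ (t x) v ^ 2) (fun _ => ‖v‖ ^ 2) (Icc 0 L) := by
    refine eqOn_Icc_of_ae_eq hL ?_ (hin.pow 2) continuousOn_const
    filter_upwards [ae_restrict_mem measurableSet_Ioo] with x hx
    have h5 : bump L x * (‖v‖ ^ 2 - inner ℝ (t x) v ^ 2) = 0 := h3 (Ioo_subset_Icc_self hx)
    have h6 := (mul_eq_zero.1 h5).resolve_left (bump_pos hx).ne'
    linarith
  have hvn : ‖v‖ ≠ 0 := norm_ne_zero_iff.2 hv0
  -- Equality in Cauchy-Schwarz: `t x = ±v / |v|`. The sign cannot change because the interval is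
  -- connected.
  have key : ∀ s : ℝ, |s| = 1 → ∀ x ∈ Icc 0 L, inner ℝ (t x) v = s * ‖v‖ →
      t x = (s * ‖v‖⁻¹) • v := by
    intro s hs x hx hxs
    rw [← sub_eq_zero, ← norm_eq_zero, ← sq_eq_zero_iff, norm_sub_sq_real, h1 x hx, norm_smul,
      inner_smul_right, hxs, norm_mul, norm_inv, norm_norm, Real.norm_eq_abs, hs]
    field_simp
    have : s ^ 2 = 1 := by rw [← sq_abs, hs, one_pow]
    rw [this]
    norm_num
  have h0 : (0 : ℝ) ∈ Icc 0 L := ⟨le_rfl, hL.le⟩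
  rcases isPreconnected_Icc.eq_or_eq_neg_of_sq_eq hin continuousOn_const h4
    (fun _ => hvn) with h5 | h5
  · intro x hx
    rw [key 1 (by simp) x hx (by simpa using h5 hx), key 1 (by simp) 0 h0 (by simpa using h5 h0)]
  · intro x hx
    rw [key (-1) (by simp) x hx (by simpa using h5 hx),
      key (-1) (by simp) 0 h0 (by simpa using h5 h0)]

/-- Curves near a nonconstant curve `t` of unit vectors can be corrected in such a way that the
integral of the normalized curve is that of `t`. -/
theorem exists_correction (hL : 0 < L) (ht : ContinuousOn t (Icc 0 L))
    (h1 : ∀ x ∈ Icc 0 L, ‖t x‖ = 1) (hinj : Function.Injective (meanDeriv L t)) {ε : ℝ}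
    (hε : 0 < ε) : ∃ τ > 0, ∀ T : ℝ → E3, ContinuousOn T (Icc 0 L) →
      (∀ x ∈ Icc 0 L, ‖T x - t x‖ ≤ τ) → ∃ s : E3, ‖s‖ ≤ ε ∧
        ∫ x in Ioo 0 L, unitize (T x + bump L x • s) = ∫ x in Ioo 0 L, t x := by
  let M : E3 ≃L[ℝ] E3 :=
    (LinearEquiv.ofInjectiveEndo (meanDeriv L t : E3 →ₗ[ℝ] E3) hinj).toContinuousLinearEquiv
  have hM : (M : E3 →L[ℝ] E3) = meanDeriv L t := by
    ext v : 1
    rfl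
  let Mi := M.toNonlinearRightInverse
  have hMi : (0 : ℝ) < Mi.nnnorm := by
    have : Mi.nnnorm = ‖(M.symm : E3 →L[ℝ] E3)‖₊ := rfl
    rw [this, coe_nnnorm]
    exact M.norm_symm_pos
  -- If `G` approximates `M` with Lipschitz error `c`, the quantitative inverse function theorem
  -- covers a ball of radius `(‖M⁻¹‖⁻¹ - c) ε' = c ε'` around `G 0`. The pointwise derivative error
  -- `c / L` integrates to `c`.
  set c : NNReal := Mi.nnnorm⁻¹ / 2 with hc
  have hc0 : (0 : ℝ) < c := by
    rw [hc]
    push_cast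
    positivity
  have hK : IsCompact (t '' Icc 0 L) := isCompact_Icc.image_of_continuousOn ht
  obtain ⟨r, hr, hr'⟩ := exists_forall_norm_fderiv_sub_le (U := {z : E3 | z ≠ 0}) hK isOpen_ne
    (by rintro _ ⟨x, hx, rfl⟩; exact ne_zero_of_norm_eq_one (h1 x hx))
    (fun z hz => contDiffAt_unitize hz) (div_pos hc0 hL)
  set ε' := min ε (r / 4) with hε'
  have hε0 : 0 < ε' := lt_min hε (by positivity)
  -- The first bound keeps `T + bump • s` in the ball of radius `r` around `t`. The second gives `‖G
  -- 0 - ∫ t‖ ≤ c ε'`, as normalization at most doubles the distance to a unit vector.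
  refine ⟨min (r / 4) (c * ε' / (2 * L)), lt_min (by positivity) (by positivity),
    fun T hT hTt => ?_⟩
  have hball : ∀ x ∈ Icc 0 L, ∀ s ∈ Metric.closedBall (0 : E3) ε',
      T x + bump L x • s ∈ Metric.ball (t x) r := by
    intro x hx s hs
    rw [mem_closedBall_zero_iff] at hs
    rw [mem_ball_iff_norm]
    have h2 : ‖bump L x • s‖ ≤ r / 4 := by
      rw [norm_smul, Real.norm_of_nonneg (bump_nonneg hx)]
      exact (mul_le_of_le_one_left (norm_nonneg _) (bump_le_one hL hx)).trans
        (hs.trans (min_le_right _ _))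
    have h3 := (hTt x hx).trans (min_le_left _ _)
    have h4 : T x + bump L x • s - t x = (T x - t x) + bump L x • s := by abel
    rw [h4]
    exact (norm_add_le _ _).trans_lt (by linarith)
  have hne : ∀ x ∈ Icc 0 L, ∀ z ∈ Metric.ball (t x) r, z ≠ 0 := fun x hx z hz =>
    (hr' (t x) ⟨x, hx, rfl⟩ z hz).1
  have hcont : ∀ s ∈ Metric.closedBall (0 : E3) ε',
      ContinuousOn (fun x => unitize (T x + bump L x • s)) (Icc 0 L) := by
    intro s hs x hx
    have h2 : ContinuousOn (fun x => T x + bump L x • s) (Icc 0 L) :=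
      hT.add ((contDiff_bump (n := 0)).continuous.continuousOn.smul continuousOn_const)
    exact ContinuousAt.comp_continuousWithinAt (f := fun x => T x + bump L x • s)
      (contDiffAt_unitize (n := 1) (hne x hx _ (hball x hx s hs))).continuousAt (h2 x hx)
  set G : E3 → E3 := fun s => ∫ x in Ioo 0 L, unitize (T x + bump L x • s) with hG
  have hvol : (vol L).real univ = L := by simp [Measure.real, ENNReal.toReal_ofReal hL.le]
  have happ : ApproximatesLinearOn G (M : E3 →L[ℝ] E3) (Metric.closedBall 0 ε') c := by
    intro s hs s' hs'
    have hd := continuousOn_fderiv_unitize ht h1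
    have hi1 : Integrable (fun x => unitize (T x + bump L x • s) - unitize (T x + bump L x • s'))
        (vol L) := integrable_of_continuousOn ((hcont s hs).sub (hcont s' hs'))
    have hi2 : Integrable (fun x => (bump L x • fderiv ℝ unitize (t x)) (s - s')) (vol L) :=
      integrable_of_continuousOn (hd.clm_apply continuousOn_const)
    rw [hM, meanDeriv, ContinuousLinearMap.integral_apply (integrable_of_continuousOn hd), hG]
    simp only
    rw [← integral_sub (integrable_of_continuousOn (hcont s hs))
      (integrable_of_continuousOn (hcont s' hs')), ← integral_sub hi1 hi2]
    have h2 : ∀ᵐ x ∂(vol L), ‖unitize (T x + bump L x • s) - unitize (T x + bump L x • s') -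
        (bump L x • fderiv ℝ unitize (t x)) (s - s')‖ ≤ c / L * ‖s - s'‖ := by
      filter_upwards [ae_restrict_mem measurableSet_Ioo] with x hx
      have hx' := Ioo_subset_Icc_self hx
      have h3 := (convex_ball (t x) r).norm_image_sub_le_of_norm_hasFDerivWithin_le'
        (f := unitize) (f' := fderiv ℝ unitize) (φ := fderiv ℝ unitize (t x)) (C := c / L)
        (fun z hz => ((contDiffAt_unitize (n := 1) (hne x hx' z hz)).differentiableAt
          (by simp)).hasFDerivAt.hasFDerivWithinAt)
        (fun z hz => (hr' (t x) ⟨x, hx', rfl⟩ z hz).2) (hball x hx' s' hs') (hball x hx' s hs)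
      have h4 : T x + bump L x • s - (T x + bump L x • s') = bump L x • (s - s') := by
        rw [smul_sub]
        abel
      rw [h4, map_smul] at h3
      refine h3.trans (mul_le_mul_of_nonneg_left ?_ (by positivity))
      rw [norm_smul, Real.norm_of_nonneg (bump_nonneg hx')]
      exact mul_le_of_le_one_left (norm_nonneg _) (bump_le_one hL hx')
    refine (norm_integral_le_of_norm_le_const h2).trans_eq ?_
    rw [hvol]
    field_simp
  have hsurj := happ.surjOn_closedBall_of_nonlinearRightInverse Mi hε0.le subset_rfl
  have hmem : ∫ x in Ioo 0 L, t x ∈ Metric.closedBall (G 0) (((Mi.nnnorm : ℝ)⁻¹ - c) * ε') := by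
    have h0 : (0 : E3) ∈ Metric.closedBall (0 : E3) ε' := Metric.mem_closedBall_self hε0.le
    have hc2 : (Mi.nnnorm : ℝ)⁻¹ - c = c := by
      rw [hc]
      push_cast
      ring
    rw [hc2, mem_closedBall_iff_norm, norm_sub_rev, hG]
    simp only
    rw [← integral_sub (integrable_of_continuousOn (hcont 0 h0)) (integrable_of_continuousOn ht)]
    have h2 : ∀ᵐ x ∂(vol L), ‖unitize (T x + bump L x • (0 : E3)) - t x‖ ≤ c * ε' / L := by
      filter_upwards [ae_restrict_mem measurableSet_Ioo] with x hx
      have hx' := Ioo_subset_Icc_self hx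
      refine (norm_unitize_sub_le (hne x hx' _ (hball x hx' 0 h0)) (h1 x hx')).trans ?_
      have h3 := (hTt x hx').trans (min_le_right _ _)
      rw [smul_zero, add_zero]
      calc 2 * ‖T x - t x‖ ≤ 2 * (c * ε' / (2 * L)) := by linarith
        _ = c * ε' / L := by field_simp
    refine (norm_integral_le_of_norm_le_const h2).trans_eq ?_
    rw [hvol]
    field_simp
  obtain ⟨s, hs, hsG⟩ := hsurj hmem
  exact ⟨s, (mem_closedBall_zero_iff.1 hs).trans (min_le_left _ _), hsG⟩

end Correction

/-! ### Smooth approximation of curves -/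

section Approximation

variable {L : ℝ}

/-- Smooth functions with a prescribed integral are dense. -/
theorem exists_smooth_near (hL : 0 < L) (v : L2 L) {ε : ℝ} (hε : 0 < ε) :
    ∃ (f : ℝ → E3) (V : L2 L), ContDiff ℝ ∞ f ∧ V =ᵐ[vol L] f ∧ ‖V - v‖ ≤ ε ∧
      prim V L = prim v L := by
  -- `Ψ` adds the constant that adjusts the integral to that of `v`. It is continuous and fixes `v`,
  -- so some smooth `G` has `Ψ G` close to `v`.
  obtain ⟨Ψ, hΨ⟩ : ∃ Ψ : L2 L → L2 L,
    ∀ G, Ψ G = G + Lp.constL 2 (vol L) ℝ (L⁻¹ • primAt L L (v - G)) := ⟨_, fun _ => rfl⟩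
  have hΨc : Continuous Ψ := by
    rw [funext hΨ]
    fun_prop
  have hΨv : Ψ v = v := by
    rw [hΨ, sub_self, map_zero, smul_zero, map_zero, add_zero]
  obtain ⟨G, ⟨g, hGg, -, hg⟩, hG⟩ := (Lp.dense_hasCompactSupport_contDiff (μ := vol L) (p := 2)
    (F := E3) (by norm_num)).exists_mem_open (Metric.isOpen_ball.preimage hΨc)
    ⟨v, (by rw [mem_preimage, hΨv]; exact Metric.mem_ball_self hε : v ∈ Ψ ⁻¹' Metric.ball v ε)⟩
  rw [mem_preimage, Metric.mem_ball] at hG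
  set d : E3 := L⁻¹ • primAt L L (v - G) with hd
  have hV : Ψ G =ᵐ[vol L] fun x => g x + d := by
    filter_upwards [hGg, Lp.coeFn_add G (Lp.const 2 (vol L) d),
      Lp.coeFn_const (p := 2) (μ := vol L) d] with x h1 h2 h3
    rw [hΨ]
    exact h2.trans (by rw [Pi.add_apply, h1, h3, Function.const_apply])
  refine ⟨fun x => g x + d, Ψ G, hg.add contDiff_const, hV, ?_, ?_⟩
  · rw [← dist_eq_norm]
    exact hG.le
  · have hLL : L ∈ Icc 0 L := ⟨hL.le, le_rfl⟩
    rw [prim_eq_integral hV hLL, intervalIntegral.integral_add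
      (hg.continuous.intervalIntegrable _ _) intervalIntegrable_const,
      ← prim_eq_integral hGg hLL, intervalIntegral.integral_const, sub_zero, hd, smul_smul,
      mul_inv_cancel₀ hL.ne', one_smul, map_sub]
    simp

theorem eq_add_prim {g g' : ℝ → E3} (hg : ∀ x ∈ Icc 0 L, HasDerivAt g (g' x) x)
    (hg' : ContinuousOn g' (Icc 0 L)) {V : L2 L} (hV : V =ᵐ[vol L] g') {x : ℝ}
    (hx : x ∈ Icc 0 L) : g x = g 0 + prim V x := by
  have hsub : uIcc 0 x ⊆ Icc 0 L := by
    rw [uIcc_of_le hx.1]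
    exact Icc_subset_Icc_right hx.2
  rw [prim_eq_integral hV hx, intervalIntegral.integral_eq_sub_of_hasDerivAt
    (fun y hy => hg y (hsub hy)) (hg'.mono hsub).intervalIntegrable, add_sub_cancel]

/-- A smooth curve, close in `H¹` to the curve with the value `c` at `0` and the derivative `v`,
with the same values at the end points. -/
structure IsApprox (L : ℝ) (c : E3) (v : L2 L) (ε : ℝ) (T : ℝ → E3) (V : L2 L) : Prop where
  smooth : ContDiff ℝ ∞ T
  deriv_eq : V =ᵐ[vol L] deriv T
  left : T 0 = c
  right : T L = c + prim v L
  close : ∀ x ∈ Icc 0 L, ‖T x - (c + prim v x)‖ ≤ ε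
  deriv_close : ‖V - v‖ ≤ ε

theorem IsApprox.hasDerivAt {c : E3} {v : L2 L} {ε : ℝ} {T : ℝ → E3} {V : L2 L}
    (h : IsApprox L c v ε T V) (x : ℝ) : HasDerivAt T (deriv T x) x :=
  (h.smooth.differentiable (by simp) x).hasDerivAt

theorem IsApprox.continuous_deriv {c : E3} {v : L2 L} {ε : ℝ} {T : ℝ → E3} {V : L2 L}
    (h : IsApprox L c v ε T V) : Continuous (deriv T) :=
  h.smooth.continuous_deriv (by simp)

theorem IsApprox.mono {c : E3} {v : L2 L} {ε ε' : ℝ} {T : ℝ → E3} {V : L2 L}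
    (h : IsApprox L c v ε T V) (hε : ε ≤ ε') : IsApprox L c v ε' T V :=
  ⟨h.smooth, h.deriv_eq, h.left, h.right, fun x hx => (h.close x hx).trans hε,
    h.deriv_close.trans hε⟩

theorem exists_isApprox (hL : 0 < L) (c : E3) (v : L2 L) {ε : ℝ} (hε : 0 < ε) :
    ∃ T V, IsApprox L c v ε T V := by
  -- `K` dominates both `1` and the norm of the primitive from `L²` to the supremum norm, so
  -- accuracy `ε / K` in the derivative suffices for both estimates.
  set K := √(max L 0) + 1 with hK
  have hK1 : 1 ≤ K := by
    rw [hK]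
    linarith [Real.sqrt_nonneg (max L 0)]
  have hK0 : 0 < K := zero_lt_one.trans_le hK1
  obtain ⟨f, V, hf, hVf, hVv, hVL⟩ := exists_smooth_near hL v (div_pos hε hK0)
  have hder : ∀ x, HasDerivAt (fun x => c + ∫ t in (0 : ℝ)..x, f t) (f x) x := fun x =>
    (intervalIntegral.integral_hasDerivAt_right (hf.continuous.intervalIntegrable _ _)
      (hf.continuous.stronglyMeasurableAtFilter _ _) hf.continuous.continuousAt).const_add c
  have hd : deriv (fun x => c + ∫ t in (0 : ℝ)..x, f t) = f := funext fun x => (hder x).deriv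
  have hprim : ∀ x ∈ Icc 0 L, ∫ t in (0 : ℝ)..x, f t = prim V x := fun x hx =>
    (prim_eq_integral hVf hx).symm
  refine ⟨fun x => c + ∫ t in (0 : ℝ)..x, f t, V, ?_, ?_, ?_, ?_, ?_, ?_⟩
  · rw [contDiff_infty_iff_deriv, hd]
    exact ⟨fun x => (hder x).differentiableAt, hf⟩
  · rwa [hd]
  · simp
  · rw [hprim L ⟨hL.le, le_rfl⟩, hVL]
  · intro x hx
    rw [hprim x hx, add_sub_add_left_eq_sub, ← primAt_apply, ← primAt_apply, ← map_sub]
    refine (norm_prim_le (V - v) x).trans ?_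
    calc √(max L 0) * ‖V - v‖ ≤ K * (ε / K) := by
          refine mul_le_mul ?_ hVv (norm_nonneg _) hK0.le
          rw [hK]
          linarith
      _ = ε := mul_div_cancel₀ _ hK0.ne'
  · exact hVv.trans (div_le_self hε.le hK1)

theorem ae_eq_zero_of_prim_eq_zero {v : L2 L} (h : ∀ x ∈ Icc 0 L, prim v x = 0) : v = 0 := by
  refine Lp.ext ?_
  filter_upwards [ae_hasDerivAt_prim v, Lp.coeFn_zero E3 2 (vol L),
    ae_restrict_mem measurableSet_Ioo] with x h1 h2 hx
  rw [h2]
  refine h1.unique ((hasDerivAt_const x (0 : E3)).congr_of_eventuallyEq ?_)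
  filter_upwards [Icc_mem_nhds hx.1 hx.2] with y hy using h y hy

/-- Smooth approximation of a curve of unit vectors such that the normalized approximation has the
same integral. -/
theorem exists_isApprox_integral_eq (hL : 0 < L) (c : E3) (v : L2 L)
    (h1 : ∀ x ∈ Icc 0 L, ‖c + prim v x‖ = 1) {ε : ℝ} (hε : 0 < ε) :
    ∃ T V, IsApprox L c v ε T V ∧
      ∫ x in Ioo 0 L, unitize (T x) = ∫ x in Ioo 0 L, (c + prim v x) := by
  have hcont : ContinuousOn (fun x => c + prim v x) (Icc 0 L) :=
    (continuous_const.add (continuous_prim v)).continuousOn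
  -- In the degenerate case the curve is constant and is its own smooth approximation.
  by_cases hinj : Function.Injective (meanDeriv L fun x => c + prim v x)
  · obtain ⟨C, hC⟩ := isCompact_Icc.exists_bound_of_continuousOn
      (f := deriv (bump L)) (s := Icc 0 L)
      ((contDiff_bump (n := 1)).continuous_deriv le_rfl).continuousOn
    have hC0 : 0 ≤ C := (norm_nonneg _).trans (hC 0 ⟨le_rfl, hL.le⟩)
    -- `κ` dominates `1` and the factor bounding the `L²` norm of `bump' • s`. Thus `‖s‖ ≤ ε / (2κ)`
    -- keeps the correction and its derivative below `ε / 2`; the end values survive because `bump`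
    -- vanishes there.
    set κ : ℝ := (measureUnivNNReal (vol L) : ℝ) ^ (2 : ENNReal).toReal⁻¹ * C + 1 with hκ
    have hκ1 : 1 ≤ κ := by
      have : 0 ≤ (measureUnivNNReal (vol L) : ℝ) ^ (2 : ENNReal).toReal⁻¹ * C := by positivity
      linarith
    have hκ0 : 0 < κ := zero_lt_one.trans_le hκ1
    obtain ⟨τ, hτ, hcorr⟩ := exists_correction hL hcont h1 hinj (ε := ε / (2 * κ)) (by positivity)
    obtain ⟨T, V, hT⟩ := exists_isApprox hL c v (lt_min hτ (half_pos hε))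
    obtain ⟨s, hs, hint⟩ := hcorr T hT.smooth.continuous.continuousOn
      fun x hx => (hT.close x hx).trans (min_le_left _ _)
    have hb : ContDiff ℝ ∞ fun x => bump L x • s := contDiff_bump.smul contDiff_const
    have hbd : ∀ x, HasDerivAt (fun x => bump L x • s) (deriv (bump L) x • s) x := fun x =>
      (((contDiff_bump (n := 1)).differentiable (by simp) x).hasDerivAt).smul_const s
    have hm : MemLp (fun x => deriv (bump L) x • s) 2 (vol L) := memLp_of_continuous
      ((((contDiff_bump (n := 1)).continuous_deriv le_rfl).smul
        continuous_const).continuousOn) 2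
    have hmn : ‖hm.toLp‖ ≤ ε / 2 := by
      have h2 : ‖hm.toLp‖ ≤ (measureUnivNNReal (vol L) : ℝ) ^ (2 : ENNReal).toReal⁻¹ *
          (C * ‖s‖) := by
        refine Lp.norm_le_of_ae_bound (by positivity) ?_
        filter_upwards [hm.coeFn_toLp, ae_restrict_mem measurableSet_Ioo] with x hx hx'
        rw [hx, norm_smul]
        exact mul_le_mul_of_nonneg_right (hC x (Ioo_subset_Icc_self hx')) (norm_nonneg _)
      refine h2.trans ?_
      calc (measureUnivNNReal (vol L) : ℝ) ^ (2 : ENNReal).toReal⁻¹ * (C * ‖s‖)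
          ≤ κ * ‖s‖ := by
            rw [← mul_assoc]
            exact mul_le_mul_of_nonneg_right (by linarith) (norm_nonneg _)
        _ ≤ κ * (ε / (2 * κ)) := mul_le_mul_of_nonneg_left hs hκ0.le
        _ = ε / 2 := by field_simp
    have hsn : ‖s‖ ≤ ε / 2 := by
      refine hs.trans ?_
      rw [div_le_div_iff₀ (by positivity) two_pos]
      nlinarith
    refine ⟨fun x => T x + bump L x • s, V + hm.toLp, ⟨hT.smooth.add hb, ?_, ?_, ?_, ?_, ?_⟩, hint⟩
    · filter_upwards [Lp.coeFn_add V hm.toLp, hT.deriv_eq, hm.coeFn_toLp] with x h2 h3 h4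
      rw [h2, Pi.add_apply, h3, h4]
      exact ((hT.hasDerivAt x).add (hbd x)).deriv.symm
    · simp [bump, hT.left]
    · simp [bump, hT.right]
    · intro x hx
      have h2 := (hT.close x hx).trans (min_le_right _ _)
      have h3 : ‖bump L x • s‖ ≤ ‖s‖ := by
        rw [norm_smul, Real.norm_of_nonneg (bump_nonneg hx)]
        exact mul_le_of_le_one_left (norm_nonneg _) (bump_le_one hL hx)
      rw [add_sub_right_comm]
      exact (norm_add_le _ _).trans (by linarith)
    · rw [add_sub_right_comm]
      have h2 := hT.deriv_close.trans (min_le_right _ _)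
      exact (norm_add_le _ _).trans (by linarith)
  · have h2 := eqOn_const_of_meanDeriv_not_injective hL hcont h1 hinj
    have h3 : ∀ x ∈ Icc 0 L, prim v x = 0 := fun x hx => by simpa using h2 x hx
    have hv := ae_eq_zero_of_prim_eq_zero h3
    have hc : ‖c‖ = 1 := by simpa using h1 0 ⟨le_rfl, hL.le⟩
    refine ⟨fun _ => c, 0, ⟨contDiff_const, ?_, rfl, ?_, fun x hx => ?_, ?_⟩, ?_⟩
    · simpa using! Lp.coeFn_zero E3 2 (vol L)
    · rw [h3 L ⟨hL.le, le_rfl⟩, add_zero]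
    · rw [h3 x hx, add_zero, sub_self, norm_zero]
      exact hε.le
    · rw [hv, sub_self, norm_zero]
      exact hε.le
    · refine setIntegral_congr_fun measurableSet_Ioo fun x hx => ?_
      simp only
      rw [h3 x (Ioo_subset_Icc_self hx), add_zero, unitize_of_norm_eq_one hc]

theorem contDiffOn_prim (hL : 0 < L) {u : L2 L} {g : ℝ → E3} (hu : u =ᵐ[vol L] g)
    (hg : ContDiffOn ℝ ∞ g (Icc 0 L)) : ContDiffOn ℝ ∞ (prim u) (Icc 0 L) := by
  -- The extension by the end values is continuous on the line, so the fundamental theorem of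
  -- calculus holds up to the end points.
  set G : ℝ → E3 := IccExtend hL.le ((Icc 0 L).domRestrict g) with hGdef
  have hGc : Continuous G := hg.continuousOn.domRestrict.Icc_extend'
  have hGg : ∀ x ∈ Icc 0 L, G x = g x := fun x hx => IccExtend_of_mem hL.le _ hx
  have huG : u =ᵐ[vol L] G := by
    filter_upwards [hu, ae_restrict_mem measurableSet_Ioo] with x hx hx'
    rw [hx, hGg x (Ioo_subset_Icc_self hx')]
  have hder : ∀ x ∈ Icc 0 L, HasDerivWithinAt (prim u) (g x) (Icc 0 L) x := by
    intro x hx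
    have h1 : HasDerivAt (fun x => ∫ t in (0 : ℝ)..x, G t) (G x) x :=
      intervalIntegral.integral_hasDerivAt_right (hGc.intervalIntegrable _ _)
        (hGc.stronglyMeasurableAtFilter _ _) hGc.continuousAt
    rw [← hGg x hx]
    exact h1.hasDerivWithinAt.congr (fun y hy => prim_eq_integral huG hy) (prim_eq_integral huG hx)
  have huniq := uniqueDiffOn_Icc hL
  rw [contDiffOn_infty_iff_derivWithin huniq]
  exact ⟨fun x hx => (hder x hx).differentiableWithinAt,
    hg.congr fun x hx => (hder x hx).derivWithin (huniq x hx)⟩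

end Approximation

/-! ### Composition with smooth maps -/

section Composition

variable {L : ℝ}

theorem norm_le_of_ae_le {f g h k l : L2 L} {a b : ℝ} (ha : 0 ≤ a) (hb : 0 ≤ b)
    (H : ∀ᵐ x ∂(vol L), ‖f x‖ ≤ a * (‖g x‖ + ‖h x‖) + b * (‖k x‖ + ‖l x‖)) :
    ‖f‖ ≤ a * (‖g‖ + ‖h‖) + b * (‖k‖ + ‖l‖) := by
  let N : L2 L → Lp ℝ 2 (vol L) := fun g => (Lp.memLp g).norm.toLp
  have hN : ∀ g, N g =ᵐ[vol L] fun x => ‖g x‖ := fun g => (Lp.memLp g).norm.coeFn_toLp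
  have hNn : ∀ g, ‖N g‖ = ‖g‖ := fun g =>
    le_antisymm (Lp.norm_le_norm_of_ae_le ((hN g).mono fun x hx => by rw [hx, norm_norm]))
      (Lp.norm_le_norm_of_ae_le ((hN g).mono fun x hx => by rw [hx, norm_norm]))
  have h1 : ‖f‖ ≤ ‖a • (N g + N h) + b • (N k + N l)‖ := by
    refine Lp.norm_le_norm_of_ae_le ?_
    filter_upwards [H, hN g, hN h, hN k, hN l, Lp.coeFn_add (a • (N g + N h)) (b • (N k + N l)),
      Lp.coeFn_smul a (N g + N h), Lp.coeFn_smul b (N k + N l), Lp.coeFn_add (N g) (N h),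
      Lp.coeFn_add (N k) (N l)] with x h1 h2 h3 h4 h5 h6 h7 h8 h9 h10
    rw [h6, Pi.add_apply, h7, h8, Pi.smul_apply, Pi.smul_apply, h9, h10, Pi.add_apply,
      Pi.add_apply, h2, h3, h4, h5, smul_eq_mul, smul_eq_mul]
    exact h1.trans (le_abs_self _)
  refine h1.trans ((norm_add_le _ _).trans (add_le_add ?_ ?_))
  · rw [norm_smul, Real.norm_of_nonneg ha, ← hNn g, ← hNn h]
    exact mul_le_mul_of_nonneg_left (norm_add_le _ _) ha
  · rw [norm_smul, Real.norm_of_nonneg hb, ← hNn k, ← hNn l]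
    exact mul_le_mul_of_nonneg_left (norm_add_le _ _) hb

/-- Composition with a smooth map is continuous at `X` in `H¹`. -/
theorem exists_norm_comp_sub_le {Ψ : E3 × E3 → E3} {U : Set (E3 × E3)} (hL : 0 < L)
    (hU : IsOpen U) (hΨ : ∀ z ∈ U, ContDiffAt ℝ 2 Ψ z) {X : ℝ → E3 × E3}
    (hX : ContinuousOn X (Icc 0 L)) (hXU : ∀ x ∈ Icc 0 L, X x ∈ U) {v w A₀ : L2 L}
    (hA₀ : ∀ᵐ x ∂(vol L), A₀ x = fderiv ℝ Ψ (X x) (v x, w x)) {ε : ℝ} (hε : 0 < ε) :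
    ∃ τ > 0, ∀ (Y : ℝ → E3 × E3) (v' w' : L2 L), (∀ x ∈ Icc 0 L, ‖Y x - X x‖ ≤ τ) →
      ‖v' - v‖ ≤ τ → ‖w' - w‖ ≤ τ → (∀ x ∈ Icc 0 L, Y x ∈ U) ∧
      ∀ A : L2 L, (∀ᵐ x ∂(vol L), A x = fderiv ℝ Ψ (Y x) (v' x, w' x)) → ‖A - A₀‖ ≤ ε := by
  have hK : IsCompact (X '' Icc 0 L) := isCompact_Icc.image_of_continuousOn hX
  have hKU : X '' Icc 0 L ⊆ U := by
    rintro _ ⟨x, hx, rfl⟩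
    exact hXU x hx
  obtain ⟨C, hC⟩ := hK.exists_bound_of_continuousOn (f := fderiv ℝ Ψ) fun z hz =>
    (((hΨ z (hKU hz)).fderiv_right (m := 1) (by norm_num)).continuousAt).continuousWithinAt
  have hC0 : 0 ≤ C := (norm_nonneg _).trans (hC _ ⟨0, ⟨le_rfl, hL.le⟩, rfl⟩)
  -- The bound `1` keeps the derivative at `Y` below `C + 1`; the other makes the term `c (‖v‖ +
  -- ‖w‖)` at most `ε / 2`.
  set c := min 1 (ε / (2 * (‖v‖ + ‖w‖ + 1))) with hc
  have hc0 : 0 < c := lt_min one_pos (by positivity)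
  obtain ⟨r, hr, hr'⟩ := exists_forall_norm_fderiv_sub_le hK hU hKU hΨ hc0
  set τ := min (r / 2) (ε / (4 * (C + 1))) with hτ
  have hτ0 : 0 < τ := lt_min (by positivity) (by positivity)
  refine ⟨τ, hτ0, fun Y v' w' hY hv hw => ?_⟩
  have hYr : ∀ x ∈ Icc 0 L, dist (Y x) (X x) < r := fun x hx => by
    rw [dist_eq_norm]
    have := (hY x hx).trans (min_le_left _ _)
    linarith
  refine ⟨fun x hx => (hr' _ ⟨x, hx, rfl⟩ _ (hYr x hx)).1, fun A hA => ?_⟩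
  have hle : ‖A - A₀‖ ≤ (C + 1) * (‖v' - v‖ + ‖w' - w‖) + c * (‖v‖ + ‖w‖) := by
    refine norm_le_of_ae_le (by positivity) hc0.le ?_
    filter_upwards [hA, hA₀, Lp.coeFn_sub A A₀, Lp.coeFn_sub v' v, Lp.coeFn_sub w' w,
      ae_restrict_mem measurableSet_Ioo] with x h1 h2 h3 h4 h5 hx
    have hx' := Ioo_subset_Icc_self hx
    have h6 := (hr' _ ⟨x, hx', rfl⟩ _ (hYr x hx')).2
    have h7 : ‖fderiv ℝ Ψ (Y x)‖ ≤ C + 1 := by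
      have h8 := hC (X x) ⟨x, hx', rfl⟩
      have h9 := norm_le_norm_add_norm_sub' (fderiv ℝ Ψ (Y x)) (fderiv ℝ Ψ (X x))
      have h10 := min_le_left 1 (ε / (2 * (‖v‖ + ‖w‖ + 1)))
      linarith
    have hpair : ∀ a b : E3, ‖(a, b)‖ ≤ ‖a‖ + ‖b‖ := fun a b => by
      rw [Prod.norm_mk]
      exact max_le_add_of_nonneg (norm_nonneg _) (norm_nonneg _)
    -- The change of the direction is small in `L²` and the change of the derivative of `Ψ` is small
    -- uniformly.
    have h8 : (A - A₀ : L2 L) x = fderiv ℝ Ψ (Y x) (v' x - v x, w' x - w x) +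
        (fderiv ℝ Ψ (Y x) - fderiv ℝ Ψ (X x)) (v x, w x) := by
      rw [h3, Pi.sub_apply, h1, h2, sub_apply, ← Prod.mk_sub_mk, map_sub]
      abel
    rw [h8, h4, h5, Pi.sub_apply, Pi.sub_apply]
    refine (norm_add_le _ _).trans (add_le_add ?_ ?_)
    · exact ((fderiv ℝ Ψ (Y x)).le_of_opNorm_le h7 _).trans
        (mul_le_mul_of_nonneg_left (hpair _ _) (by positivity))
    · exact (ContinuousLinearMap.le_of_opNorm_le _ h6 _).trans
        (mul_le_mul_of_nonneg_left (hpair _ _) hc0.le)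
  refine hle.trans ?_
  have h1 : (C + 1) * (‖v' - v‖ + ‖w' - w‖) ≤ ε / 2 := by
    have h2 : τ ≤ ε / (4 * (C + 1)) := min_le_right _ _
    calc (C + 1) * (‖v' - v‖ + ‖w' - w‖) ≤ (C + 1) * (2 * (ε / (4 * (C + 1)))) :=
          mul_le_mul_of_nonneg_left (by linarith) (by positivity)
      _ = ε / 2 := by
          field_simp
          norm_num
  have h2 : c * (‖v‖ + ‖w‖) ≤ ε / 2 := by
    calc c * (‖v‖ + ‖w‖) ≤ ε / (2 * (‖v‖ + ‖w‖ + 1)) * (‖v‖ + ‖w‖ + 1) :=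
          mul_le_mul (min_le_right _ _) (by linarith) (by positivity) (by positivity)
      _ = ε / 2 := by field_simp
  linarith

end Composition

/-! ### Density of smooth frames -/

section SmoothFrames

variable {L : ℝ} {W : Type*} [NormedAddCommGroup W] [NormedSpace ℝ W] {Lbc : BdryVals →L[ℝ] W}
  {lbc : W}

/-- The derivative of the composition with a map that reproduces the curve. -/
theorem ae_eq_fderiv_of_comp_eq {Ψ : E3 × E3 → E3} {U : Set (E3 × E3)}
    (hΨ : ∀ z ∈ U, ContDiffAt ℝ 2 Ψ z) {f t b : ℝ → E3} {u v w : L2 L}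
    (hU : ∀ x ∈ Icc 0 L, (t x, b x) ∈ U) (hΨf : ∀ x ∈ Icc 0 L, Ψ (t x, b x) = f x)
    (hf : ∀ᵐ x ∂(vol L), HasDerivAt f (u x) x) (ht : ∀ᵐ x ∂(vol L), HasDerivAt t (v x) x)
    (hb : ∀ᵐ x ∂(vol L), HasDerivAt b (w x) x) :
    ∀ᵐ x ∂(vol L), u x = fderiv ℝ Ψ (t x, b x) (v x, w x) := by
  filter_upwards [hf, ht, hb, ae_restrict_mem measurableSet_Ioo] with x h1 h2 h3 hx
  have h4 := ((hΨ _ (hU x (Ioo_subset_Icc_self hx))).differentiableAt (by simp)).hasFDerivAt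
  have h5 : HasDerivAt (fun x => Ψ (t x, b x)) (fderiv ℝ Ψ (t x, b x) (v x, w x)) x :=
    h4.comp_hasDerivAt x (h2.prodMk h3)
  refine h1.unique (h5.congr_of_eventuallyEq ?_)
  filter_upwards [Icc_mem_nhds hx.1 hx.2] with y hy using (hΨf y hy).symm

/-- Smooth orthonormal frames with the boundary values and the integral of the tangent of an
admissible frame are admissible. -/
theorem mk_mem_admissible (hL : 0 < L) {p : H2 L × H1 L} (hp : p ∈ admissible L Lbc lbc)
    {v w : L2 L} {f g : ℝ → E3} (hf : ContDiffOn ℝ ∞ f (Icc 0 L))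
    (hg : ContDiffOn ℝ ∞ g (Icc 0 L))
    (horth : ∀ x ∈ Icc 0 L, ‖f x‖ = 1 ∧ ‖g x‖ = 1 ∧ inner ℝ (f x) (g x) = 0)
    (hfv : ∀ x ∈ Icc 0 L, f x = tangentAt L 0 p + prim v x)
    (hgw : ∀ x ∈ Icc 0 L, g x = directorAt L 0 p + prim w x)
    (hint : ∫ x in Ioo 0 L, f x = ∫ x in Ioo 0 L, tangentAt L x p)
    (hfL : f L = tangentAt L L p) (hgL : g L = directorAt L L p) :
    (mkH2 hL (positionAt L 0 p) (tangentAt L 0 p) v, mkH1 hL (directorAt L 0 p) w) ∈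
        admissible L Lbc lbc ∧
      IsSmooth (mkH2 hL (positionAt L 0 p) (tangentAt L 0 p) v) ∧
      IsSmooth (mkH1 hL (directorAt L 0 p) w) := by
  obtain ⟨-, hbc⟩ := (mem_admissible_iff hL p).1 hp
  have h0 : (0 : ℝ) ∈ Icc 0 L := ⟨le_rfl, hL.le⟩
  have hLL : L ∈ Icc 0 L := ⟨hL.le, le_rfl⟩
  have hu : affPrim (tangentAt L 0 p) v =ᵐ[vol L] f := by
    filter_upwards [coeFn_affPrim (tangentAt L 0 p) v, ae_restrict_mem measurableSet_Ioo]
      with x h1 hx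
    rw [h1, hfv x (Ioo_subset_Icc_self hx)]
  set q : H2 L × H1 L := (mkH2 hL (positionAt L 0 p) (tangentAt L 0 p) v,
    mkH1 hL (directorAt L 0 p) w) with hq
  have hqt : ∀ x ∈ Icc 0 L, tangentAt L x q = f x := fun x hx =>
    (crep_affPrim hL (tangentAt L 0 p) v x).trans (hfv x hx).symm
  have hqb : ∀ x ∈ Icc 0 L, directorAt L x q = g x := fun x hx =>
    (crep_affPrim hL (directorAt L 0 p) w x).trans (hgw x hx).symm
  have hqp : ∀ x, positionAt L x q =
      positionAt L 0 p + prim (affPrim (tangentAt L 0 p) v) x := fun x => crep_affPrim hL _ _ x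
  -- Since `y(L) = y(0) + ∫ y'`, the integral constraint on the tangent is what preserves this
  -- boundary value.
  have hpos : positionAt L L q = positionAt L L p := by
    have h1 : positionAt L L p = positionAt L 0 p + prim (D 1 p.1) L := crep_eq _ _ L
    have h2 : ∫ x in (0 : ℝ)..L, f x = ∫ x in (0 : ℝ)..L, tangentAt L x p := by
      rw [intervalIntegral.integral_of_le hL.le, intervalIntegral.integral_of_le hL.le,
        integral_Ioc_eq_integral_Ioo, integral_Ioc_eq_integral_Ioo, hint]
    have h3 : prim (D 1 p.1) L = ∫ x in (0 : ℝ)..L, tangentAt L x p :=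
      prim_eq_integral (isContRep_tangent hL p).2 hLL
    rw [hqp, h1, prim_eq_integral hu hLL, h3, h2]
  refine ⟨(mem_admissible_iff hL q).2 ⟨fun x hx => ?_, ?_⟩, ?_, ?_⟩
  · rw [hqt x hx, hqb x hx]
    exact horth x hx
  · rw [← hbc]
    refine congrArg Lbc ?_
    simp only [bdryVals, Prod.mk.injEq]
    refine ⟨by rw [hqp, prim_zero, add_zero], hpos, ?_, ?_, ?_, ?_⟩
    · rw [hqt 0 h0, hfv 0 h0, prim_zero, add_zero]
    · rw [hqt L hLL, hfL]
    · rw [hqb 0 h0, hgw 0 h0, prim_zero, add_zero]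
    · rw [hqb L hLL, hgL]
  · refine ⟨fun x => positionAt L 0 p + prim (affPrim (tangentAt L 0 p) v) x,
      contDiffOn_const.add (contDiffOn_prim hL hu hf), ?_⟩
    exact coeFn_affPrim (positionAt L 0 p) (affPrim (tangentAt L 0 p) v)
  · refine ⟨g, hg, ?_⟩
    filter_upwards [coeFn_affPrim (directorAt L 0 p) w, ae_restrict_mem measurableSet_Ioo]
      with x h1 hx
    exact h1.trans (hgw x (Ioo_subset_Icc_self hx)).symm

/-- The composition of a smooth map with a pair of smooth curves. -/
theorem IsApprox.exists_comp {c d : E3} {v w V V' : L2 L} {ε ε' : ℝ} {T B : ℝ → E3}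
    (hT : IsApprox L c v ε T V) (hB : IsApprox L d w ε' B V') {Ψ : E3 × E3 → E3}
    {U : Set (E3 × E3)} (hΨ : ∀ (n : WithTop ℕ∞), ∀ z ∈ U, ContDiffAt ℝ n Ψ z)
    (hU : ∀ x ∈ Icc 0 L, (T x, B x) ∈ U) :
    ContDiffOn ℝ ∞ (fun x => Ψ (T x, B x)) (Icc 0 L) ∧
      ∃ A : L2 L, (∀ᵐ x ∂(vol L), A x = fderiv ℝ Ψ (T x, B x) (V x, V' x)) ∧
        ∀ x ∈ Icc 0 L, Ψ (T x, B x) = Ψ (c, d) + prim A x := by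
  have hYs : ContDiff ℝ ∞ fun x => (T x, B x) := hT.smooth.prodMk hB.smooth
  have hs : ContDiffOn ℝ ∞ (fun x => Ψ (T x, B x)) (Icc 0 L) := fun x hx =>
    ((hΨ _ _ (hU x hx)).comp x hYs.contDiffAt).contDiffWithinAt
  have hd : ∀ x ∈ Icc 0 L, HasDerivAt (fun x => Ψ (T x, B x))
      (fderiv ℝ Ψ (T x, B x) (deriv T x, deriv B x)) x := fun x hx =>
    ((hΨ 1 _ (hU x hx)).differentiableAt (by simp)).hasFDerivAt.comp_hasDerivAt x
      ((hT.hasDerivAt x).prodMk (hB.hasDerivAt x))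
  have hc : ContinuousOn (fun x => fderiv ℝ Ψ (T x, B x) (deriv T x, deriv B x)) (Icc 0 L) := by
    have h1 : ContinuousOn (fun x => fderiv ℝ Ψ (T x, B x)) (Icc 0 L) := fun x hx =>
      ContinuousAt.comp_continuousWithinAt (f := fun x => (T x, B x))
        ((hΨ 2 _ (hU x hx)).fderiv_right (m := 1) (by norm_num)).continuousAt
        hYs.continuous.continuousWithinAt
    exact h1.clm_apply (hT.continuous_deriv.prodMk hB.continuous_deriv).continuousOn
  have hm := memLp_of_continuous hc 2
  refine ⟨hs, hm.toLp, ?_, fun x hx => ?_⟩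
  · filter_upwards [hm.coeFn_toLp, hT.deriv_eq, hB.deriv_eq] with x h1 h2 h3
    rw [h1, h2, h3]
  · have := eq_add_prim hd hc hm.coeFn_toLp hx
    rwa [hT.left, hB.left] at this

theorem exists_smooth_admissible_near (hL : 0 < L) {p : H2 L × H1 L}
    (hp : p ∈ admissible L Lbc lbc) {ε : ℝ} (hε : 0 < ε) :
    ∃ v w : L2 L, ‖v - D 2 p.1‖ ≤ ε ∧ ‖w - D 1 p.2‖ ≤ ε ∧
      (mkH2 hL (positionAt L 0 p) (tangentAt L 0 p) v, mkH1 hL (directorAt L 0 p) w) ∈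
        admissible L Lbc lbc ∧
      IsSmooth (mkH2 hL (positionAt L 0 p) (tangentAt L 0 p) v) ∧
      IsSmooth (mkH1 hL (directorAt L 0 p) w) := by
  obtain ⟨horth, -⟩ := (mem_admissible_iff hL p).1 hp
  have h0 : (0 : ℝ) ∈ Icc 0 L := ⟨le_rfl, hL.le⟩
  have hLL : L ∈ Icc 0 L := ⟨hL.le, le_rfl⟩
  set t : ℝ → E3 := fun x => tangentAt L x p with ht
  set b : ℝ → E3 := fun x => directorAt L x p with hb
  have hteq : ∀ x, t x = t 0 + prim (D 2 p.1) x := fun x => crep_eq _ _ x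
  have hbeq : ∀ x, b x = b 0 + prim (D 1 p.2) x := fun x => crep_eq _ _ x
  have htc : Continuous t := continuous_crep _ _
  have hbcont : Continuous b := continuous_crep _ _
  have hX : ∀ x ∈ Icc 0 L, (t x, b x) ∈ nondegenerate := fun x hx =>
    mem_nondegenerate (horth x hx).1 (horth x hx).2.1 (horth x hx).2.2
  have hXt : ∀ x ∈ Icc 0 L, unitize (t x) = t x := fun x hx =>
    unitize_of_norm_eq_one (horth x hx).1
  have hXb : ∀ x ∈ Icc 0 L, unitNormal (t x, b x) = b x := fun x hx =>
    unitNormal_of_orthonormal (horth x hx).1 (horth x hx).2.1 (horth x hx).2.2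
  have htd : ∀ᵐ x ∂(vol L), HasDerivAt t (D 2 p.1 x) x := ae_hasDerivAt_crep _ _
  have hbd : ∀ᵐ x ∂(vol L), HasDerivAt b (D 1 p.2 x) x := ae_hasDerivAt_crep _ _
  have hXc : ContinuousOn (fun x => (t x, b x)) (Icc 0 L) := (htc.prodMk hbcont).continuousOn
  -- The Gram-Schmidt maps reproduce an orthonormal frame, so by the chain rule the reference
  -- derivatives are `y''` and `b'` themselves.
  obtain ⟨τ₁, hτ₁, H₁⟩ := exists_norm_comp_sub_le hL isOpen_nondegenerate
    (fun z hz => contDiffAt_tangentMap hz) hXc hX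
    (ae_eq_fderiv_of_comp_eq (fun z hz => contDiffAt_tangentMap hz) hX hXt htd htd hbd) hε
  obtain ⟨τ₂, hτ₂, H₂⟩ := exists_norm_comp_sub_le hL isOpen_nondegenerate
    (fun z hz => contDiffAt_unitNormal hz) hXc hX
    (ae_eq_fderiv_of_comp_eq (fun z hz => contDiffAt_unitNormal hz) hX hXb hbd htd hbd) hε
  have hτ : 0 < min τ₁ τ₂ := lt_min hτ₁ hτ₂
  -- Only the tangent needs the integral correction: the boundary condition sees `b` through its end
  -- values alone.
  obtain ⟨T, V, hT, hTint⟩ := exists_isApprox_integral_eq hL (t 0) (D 2 p.1)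
    (fun x hx => by rw [← hteq]; exact (horth x hx).1) hτ
  obtain ⟨B, V', hB⟩ := exists_isApprox hL (b 0) (D 1 p.2) hτ
  have hclose : ∀ x ∈ Icc 0 L, ‖(T x, B x) - (t x, b x)‖ ≤ min τ₁ τ₂ := by
    intro x hx
    rw [Prod.mk_sub_mk, Prod.norm_mk, hteq x, hbeq x]
    exact max_le (hT.close x hx) (hB.close x hx)
  obtain ⟨hYU, H₁⟩ := H₁ (fun x => (T x, B x)) V V'
    (fun x hx => (hclose x hx).trans (min_le_left _ _))
    (hT.deriv_close.trans (min_le_left _ _)) (hB.deriv_close.trans (min_le_left _ _))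
  replace hYU : ∀ x ∈ Icc 0 L, (T x, B x) ∈ nondegenerate := hYU
  obtain ⟨-, H₂⟩ := H₂ (fun x => (T x, B x)) V V'
    (fun x hx => (hclose x hx).trans (min_le_right _ _))
    (hT.deriv_close.trans (min_le_right _ _)) (hB.deriv_close.trans (min_le_right _ _))
  obtain ⟨hs₁, v, hv, hvt⟩ :=
    hT.exists_comp hB (fun _ z hz => contDiffAt_tangentMap hz) hYU
  obtain ⟨hs₂, w, hw, hwb⟩ :=
    hT.exists_comp hB (fun _ z hz => contDiffAt_unitNormal hz) hYU
  simp only [hXt 0 h0] at hvt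
  simp only [hXb 0 h0] at hwb
  refine ⟨v, w, H₁ v hv, H₂ w hw, mk_mem_admissible hL hp hs₁ hs₂ (fun x hx => ?_) hvt hwb
    ?_ ?_ ?_⟩
  · exact ⟨norm_unitize (hYU x hx).1, norm_unitNormal (hYU x hx),
      inner_unitize_unitNormal (hYU x hx)⟩
  · rw [hTint]
    exact integral_congr_ae (Eventually.of_forall fun x => (hteq x).symm)
  · rw [hT.right, ← hteq, hXt L hLL]
  · rw [hT.right, hB.right, ← hteq, ← hbeq, hXb L hLL]

/-- Smooth admissible frames are dense in the set of admissible frames. -/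
theorem exists_smooth_admissible_seq (hL : 0 < L) {p : H2 L × H1 L}
    (hp : p ∈ admissible L Lbc lbc) :
    ∃ q : ℕ → H2 L × H1 L, StrongConv q p ∧
      ∀ n, q n ∈ admissible L Lbc lbc ∧ IsSmooth (q n).1 ∧ IsSmooth (q n).2 := by
  choose v w hv hw hA hs₁ hs₂ using fun n : ℕ =>
    exists_smooth_admissible_near hL hp (Nat.one_div_pos_of_nat (α := ℝ) (n := n))
  have hlim : ∀ {u : ℕ → L2 L} {u₀ : L2 L}, (∀ n : ℕ, ‖u n - u₀‖ ≤ 1 / ((n : ℝ) + 1)) →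
      Tendsto u atTop (𝓝 u₀) := fun h => tendsto_iff_norm_sub_tendsto_zero.2
    (squeeze_zero (fun _ => norm_nonneg _) h tendsto_one_div_add_atTop_nhds_zero_nat)
  exact ⟨_, (tendsto_mkH2 hL p.1 (hlim hv)).prodMk_nhds (tendsto_mkH1 hL p.2 (hlim hw)),
    fun n => ⟨hA n, hs₁ n, hs₂ n⟩⟩

theorem exists_smooth_approximation (hL : 0 < L) {p : H2 L × H1 L}
    (hp : p ∈ admissible L Lbc lbc) (hu : Unshearable p) {σ : ℝ} (hσ : 0 < σ) :
    ∃ q ∈ admissible L Lbc lbc, IsSmooth q.1 ∧ IsSmooth q.2 ∧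
      ‖p.1 - q.1‖ + ‖p.2 - q.2‖ + √(shearSq q) ≤ σ ∧ |energy p - energy q| ≤ σ := by
  obtain ⟨q, hq, hqA⟩ := exists_smooth_admissible_seq hL hp
  have h1 : Tendsto (fun n => ‖p.1 - (q n).1‖) atTop (𝓝 0) := by
    simpa using ((continuous_fst.tendsto p).comp hq).const_sub p.1 |>.norm
  have h2 : Tendsto (fun n => ‖p.2 - (q n).2‖) atTop (𝓝 0) := by
    simpa using ((continuous_snd.tendsto p).comp hq).const_sub p.2 |>.norm
  have h3 : Tendsto (fun n => √(shearSq (q n))) atTop (𝓝 0) := by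
    simpa using (hq.tendsto_shearSq hL (fun n => (hqA n).1) hu).sqrt
  have h4 : Tendsto (fun n => |energy p - energy (q n)|) atTop (𝓝 0) := by
    simpa using ((continuous_energy.tendsto p).comp hq).const_sub (energy p) |>.abs
  have h5 := (h1.add h2).add h3
  simp only [add_zero] at h5
  obtain ⟨n, hn1, hn2⟩ := ((h5.eventually (gt_mem_nhds hσ)).and
    (h4.eventually (gt_mem_nhds hσ))).exists
  exact ⟨q n, (hqA n).1, (hqA n).2.1, (hqA n).2.2, hn1.le, hn2.le⟩

end SmoothFrames

end Ribbon

end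

theorem proposition3p3
    (L : ℝ) (hL : 0 < L)
    (m : ℝ → ℝ → ℝ) (c₀ c₁ c₂ cuni : ℝ) (hm : Ribbon.IsRegModulus m c₀ c₁ c₂ cuni)
    {W : Type*} [NormedAddCommGroup W] [NormedSpace ℝ W]
    (Lbc : Ribbon.BdryVals →L[ℝ] W) (lbc : W) :
    -- strong approximability, with a constant that does not depend on the frame
    (∃ c : ℝ, 0 < c ∧
      ∀ p ∈ Ribbon.admissible L Lbc lbc, Ribbon.Unshearable p →
        ∀ σ : ℝ, 0 < σ →
          ∃ q ∈ Ribbon.admissible L Lbc lbc,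
            Ribbon.IsSmooth q.1 ∧ Ribbon.IsSmooth q.2 ∧
            ‖p.1 - q.1‖ + ‖p.2 - q.2‖ + √(Ribbon.shearSq q) ≤ σ ∧
            ∀ δ ε₂ : ℝ, 0 ≤ δ → 0 < ε₂ →
              |Ribbon.energy p - Ribbon.energyReg m δ ε₂ q| ≤ c * (σ ^ 2 * ε₂⁻¹ + δ + σ)) ∧
    -- convergence to the constrained functional as both parameters vanish
    (∀ δ ε₂ : ℕ → ℝ, (∀ n, 0 ≤ δ n) → (∀ n, 0 < ε₂ n) →
      Tendsto δ atTop (𝓝 0) → Tendsto ε₂ atTop (𝓝 0) →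
        Ribbon.IsGammaLimit
          (fun n => Ribbon.constrained (Ribbon.admissible L Lbc lbc)
            (Ribbon.energyReg m (δ n) (ε₂ n)))
          (Ribbon.constrained {p | p ∈ Ribbon.admissible L Lbc lbc ∧ Ribbon.Unshearable p}
            Ribbon.energy)) ∧
    -- convergence to the penalized functional for a fixed penalty parameter
    (∀ ε₂ : ℝ, 0 < ε₂ → ∀ δ : ℕ → ℝ, (∀ n, 0 ≤ δ n) → Tendsto δ atTop (𝓝 0) →
        Ribbon.IsGammaLimit
          (fun n => Ribbon.constrained (Ribbon.admissible L Lbc lbc)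
            (Ribbon.energyReg m (δ n) ε₂))
          (Ribbon.constrained (Ribbon.admissible L Lbc lbc) (Ribbon.energyReg m 0 ε₂))) := by
  -- The `1` pays for `|E p - E q| ≤ σ` and for the penalty, at most `σ² / ε₂`; `5/2 · cuni · L`
  -- pays for the regularization.
  refine ⟨⟨1 + 5 / 2 * cuni * L, ?_, fun p hp hu σ hσ => ?_⟩,
    fun δ ε hδ hε hδ0 hε0 => Ribbon.isGammaLimit_vanishing_penalty hL hm hδ hε hδ0 hε0,
    fun ε hε δ hδ hδ0 => Ribbon.isGammaLimit_fixed_penalty hL hm hε hδ hδ0⟩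
  · have := hm.cuni_nonneg
    positivity
  · obtain ⟨q, hq, hq1, hq2, hclose, hE⟩ := Ribbon.exists_smooth_approximation hL hp hu hσ
    refine ⟨q, hq, hq1, hq2, hclose, fun δ ε hδ hε => ?_⟩
    have hK : 0 ≤ 5 / 2 * cuni * L := by
      have := hm.cuni_nonneg
      positivity
    have h1 := hm.abs_energyReg_sub_le hL.le hδ ε q
    have h2 : Ribbon.shearSq q ≤ σ ^ 2 := by
      refine (Real.sqrt_le_left hσ.le).1 ?_
      linarith [norm_nonneg (p.1 - q.1), norm_nonneg (p.2 - q.2)]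
    have h3 : 1 / (2 * ε) * Ribbon.shearSq q ≤ σ ^ 2 * ε⁻¹ := by
      have h4 : 1 / (2 * ε) ≤ ε⁻¹ := by
        rw [one_div]
        exact inv_anti₀ hε (by linarith)
      rw [mul_comm (σ ^ 2)]
      exact mul_le_mul h4 h2 (Ribbon.shearSq_nonneg q) (by positivity)
    have h5 : 0 ≤ 1 / (2 * ε) * Ribbon.shearSq q :=
      mul_nonneg (by positivity) (Ribbon.shearSq_nonneg q)
    have h6 : 0 ≤ σ ^ 2 * ε⁻¹ := by positivity
    rw [abs_le] at h1 hE ⊢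
    -- These are the surplus cross terms from expanding the product on the right.
    have h7 : 0 ≤ 5 / 2 * cuni * L * (σ ^ 2 * ε⁻¹ + σ) := by positivity
    constructor <;> nlinarith
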